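/- Let $\Lambda<0$. Consider solutions $(a,b)$, $a,b>0$, on their maximal interval of existence $I$, of the vacuum Einstein equations for the Kantowski--Sachs metric $-dt^2+a(t)^2dz^2+b(t)^2\sigma$ on $I\times\mathbb S^1\times\mathbb S^2$ ($\sigma$ the round metric of curvature $1$), i.e. $$\ddot b=-\frac{\dot b^2}{b}-|\Lambda|b-\frac1b-\frac{\dot a\dot b}{a},\qquad \ddot a=-|\Lambda|a-2\frac{\dot a\dot b}{b},\qquad 0=|\Lambda|+\frac1{b^2}+\frac{\dot b^2}{b^2}+2\frac{\dot a\dot b}{ab}.$$ Let $H=\frac{\dot a}{a}+2\frac{\dot b}{b}$ be the mean curvature, $\sigma_s=\frac{\dot a}{a}-2\frac{\dot b}{b}$, $N=\sqrt{|\Lambda|+H^2/9}$, and $(H_N,\sigma_N)=\left(\frac{H}{3N},\frac{\sigma_s}{3N}\right)$. Let $S$ be the set of $(h,s)\in[-1,1]\times\mathbb R$ with $\frac19(1-h^2)+\frac5{16}h^2-\frac3{16}s^2-\frac18hs<0$, and let $$AF=\Big\{(h,s)\in S: s>\tfrac{4\sqrt{2h^2+1}-\sqrt3h}{3\sqrt3}\Big\},\qquad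 CD=\Big\{(h,s)\in S: s<-\tfrac{4\sqrt{2h^2+1}+\sqrt3h}{3\sqrt3}\Big\}.$$ Then $S$ is the disjoint union of $AF$ and $CD$, and both are invariant under the flow of the expansion-normalised system $h'=(1-h^2)q$, $s'=\frac98s^2-\frac94hs-\frac13(1-h^2)-\frac{15}8h^2-shq$, where $q=-\frac98(h^2+s^2)-\frac34hs-\frac13(1-h^2)$. For every maximal solution, $I=(T_-,T_+)$ is bounded; the spacetime recollapses, i.e. all timelike geodesics of $I\times\mathbb S^1\times\mathbb S^2$ are past and future incomplete; $H$ takes on all real values on $I$; and the singularities are crushing: $H\to+\infty$ as $t\to T_-$ and $H\to-\infty$ as $t\to T_+$. The orbit $(H_N,\sigma_N)$ lies entirely in $AF$ or entirely in $CD$. 1. If $(H_N,\sigma_N)$ lies in $AF$ at some time, then it tends to $(1,1)$ as $t\to T_-$ and to $(-1,\frac53)$ as $t\to T_+$. The solution is past asymptotic to a pancake solution: for some constants $A,B>0$ and $c$ with $\cos(\sqrt{|\Lambda|}(c+T_-))=0$ and $\cos(\sqrt{|\Lambda|}(c+t))>0$ near $T_-$, $a\sim A\cos(\sqrt{|\Lambda|}(c+t))$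 and $b\to B$ as $t\to T_-$. It is future asymptotic to a Kasner-type solution: for some constants $A,B>0$ and $c$ with $\cos(\sqrt{|\Lambda|}(c+T_+))=0$ and $\cos(\sqrt{|\Lambda|}(c+t))>0$ near $T_+$, $a\sim A\cos^{-1/3}(\sqrt{|\Lambda|}(c+t))$ and $b\sim B\cos^{2/3}(\sqrt{|\Lambda|}(c+t))$ as $t\to T_+$; in particular $a\to\infty$, $b\to0$. The future singularity is a curvature singularity: the Kretschmann scalar $$\frac{8\ddot b^2}{b^2}+\frac{4\dot b^4}{b^4}+\frac{8\dot a^2\dot b^2}{a^2b^2}+\frac{8\dot b^2}{b^4}+\frac4{b^4}+\frac{4\ddot a^2}{a^2}$$ diverges to $+\infty$ as $t\to T_+$. 2. If $(H_N,\sigma_N)$ lies in $CD$ at some time, the same holds with past and future exchanged: it tends to $(1,-\frac53)$ as $t\to T_-$ and to $(-1,-1)$ as $t\to T_+$; the solution is future asymptotic to a pancake solution and past asymptotic to a Kasner-type solution in the above sense (with $T_-$ and $T_+$ exchanged), so that $a\to\infty$, $b\to0$ and the Kretschmann scalar diverges to $+\infty$ as $t\to T_-$. -/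

import Mathlib

open Set Filter Topology Asymptotics

namespace KantowskiSachs

noncomputable section

/-- `(a, b)` is a solution on the open interval `I` of the vacuum Einstein equations with
cosmological constant `Λ < 0` for the metric `-dt² + a(t)² dz² + b(t)² σ`, where `σ` is the round
metric of curvature one on the two-sphere and the scale factors `a, b` are positive: two evolution
equations and the Hamiltonian constraint. -/
structure IsSolution (Λ : ℝ) (I : Set ℝ) (a b : ℝ → ℝ) : Prop where
  isOpen : IsOpen I
  ordConnected : I.OrdConnected
  nonempty : I.Nonempty
  a_pos : ∀ t ∈ I, 0 < a t
  b_pos : ∀ t ∈ I, 0 < b t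
  a_diff : ∀ t ∈ I, DifferentiableAt ℝ a t
  b_diff : ∀ t ∈ I, DifferentiableAt ℝ b t
  a_diff_two : ∀ t ∈ I, DifferentiableAt ℝ (deriv a) t
  b_diff_two : ∀ t ∈ I, DifferentiableAt ℝ (deriv b) t
  evolution_b : ∀ t ∈ I,
    deriv (deriv b) t = -(deriv b t) ^ 2 / b t - |Λ| * b t - 1 / b t - deriv a t * deriv b t / a t
  evolution_a : ∀ t ∈ I,
    deriv (deriv a) t = -|Λ| * a t - 2 * (deriv a t * deriv b t / b t)
  constraint : ∀ t ∈ I,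
    0 = |Λ| + 1 / b t ^ 2 + deriv b t ^ 2 / b t ^ 2 + 2 * (deriv b t * deriv a t / (b t * a t))

/-- A solution that is not the restriction of a solution on a larger interval. -/
def IsMaximalSolution (Λ : ℝ) (I : Set ℝ) (a b : ℝ → ℝ) : Prop :=
  IsSolution Λ I a b ∧
    ∀ (J : Set ℝ) (a' b' : ℝ → ℝ), IsSolution Λ J a' b' → I ⊆ J → EqOn a' a I → EqOn b' b I →
      J = I

/-- The mean curvature `H = a'/a + 2 b'/b` of the slices of constant `t`. -/
def meanCurvature (a b : ℝ → ℝ) (t : ℝ) : ℝ :=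
  deriv a t / a t + 2 * (deriv b t / b t)

/-- The shear variable `σ = a'/a - 2 b'/b`. -/
def shear (a b : ℝ → ℝ) (t : ℝ) : ℝ :=
  deriv a t / a t - 2 * (deriv b t / b t)

/-- The Kretschmann scalar `R^{αβγδ} R_{αβγδ}` of `-dt² + a(t)² dz² + b(t)² σ`. -/
def kretschmann (a b : ℝ → ℝ) (t : ℝ) : ℝ :=
  8 * deriv (deriv b) t ^ 2 / b t ^ 2 + 4 * deriv b t ^ 4 / b t ^ 4
    + 8 * deriv a t ^ 2 * deriv b t ^ 2 / (a t ^ 2 * b t ^ 2)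
    + 8 * deriv b t ^ 2 / b t ^ 4 + 4 / b t ^ 4 + 4 * deriv (deriv a) t ^ 2 / a t ^ 2

/-- `s ↦ (t s, z s, x s)`, `s ∈ J`, is an affinely parametrised timelike geodesic of
`-dt² + a(t)² dz² + b(t)² σ` on `I × S¹ × S²`. The circle coordinate `z` is lifted to `ℝ`, which
is possible for every curve defined on an interval, and `S²` is the unit sphere of Euclidean
three-space, so that the covariant acceleration of `x` in `S²` is `x'' + ‖x'‖² x`. -/
structure IsTimelikeGeodesic (I : Set ℝ) (a b : ℝ → ℝ) (J : Set ℝ) (t z : ℝ → ℝ)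
    (x : ℝ → EuclideanSpace ℝ (Fin 3)) : Prop where
  isOpen : IsOpen J
  ordConnected : J.OrdConnected
  mem : ∀ s ∈ J, t s ∈ I
  sphere : ∀ s ∈ J, ‖x s‖ = 1
  t_diff : ∀ s ∈ J, DifferentiableAt ℝ t s ∧ DifferentiableAt ℝ (deriv t) s
  z_diff : ∀ s ∈ J, DifferentiableAt ℝ z s ∧ DifferentiableAt ℝ (deriv z) s
  x_diff : ∀ s ∈ J, DifferentiableAt ℝ x s ∧ DifferentiableAt ℝ (deriv x) s
  geodesic_t : ∀ s ∈ J,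
    deriv (deriv t) s + a (t s) * deriv a (t s) * deriv z s ^ 2
      + b (t s) * deriv b (t s) * ‖deriv x s‖ ^ 2 = 0
  geodesic_z : ∀ s ∈ J,
    deriv (deriv z) s + 2 * (deriv a (t s) / a (t s)) * deriv t s * deriv z s = 0
  geodesic_x : ∀ s ∈ J,
    deriv (deriv x) s + (2 * (deriv b (t s) / b (t s)) * deriv t s) • deriv x s
      + (‖deriv x s‖ ^ 2) • x s = 0
  timelike : ∀ s ∈ J,
    -(deriv t s) ^ 2 + a (t s) ^ 2 * deriv z s ^ 2 + b (t s) ^ 2 * ‖deriv x s‖ ^ 2 < 0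

/-- Every timelike geodesic is past and future incomplete: its affine parameter is confined to a
bounded interval. -/
def Recollapses (I : Set ℝ) (a b : ℝ → ℝ) : Prop :=
  ∀ (J : Set ℝ) (t z : ℝ → ℝ) (x : ℝ → EuclideanSpace ℝ (Fin 3)),
    IsTimelikeGeodesic I a b J t z x → BddBelow J ∧ BddAbove J

/-! ### The compactified state space -/

/-- The expansion-normalised variables `(H_N, σ_N) = (H / (3N), σ / (3N))` with
`N = √(|Λ| + H² / 9)`. -/
def statePoint (Λ : ℝ) (a b : ℝ → ℝ) (t : ℝ) : ℝ × ℝ :=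
  let H := meanCurvature a b t
  let N := √(|Λ| + H ^ 2 / 9)
  (H / (3 * N), shear a b t / (3 * N))

/-- The compactified state space: `H_N ∈ [-1, 1]` together with the constraint inequality. -/
def stateSpace : Set (ℝ × ℝ) :=
  {p | p.1 ∈ Icc (-1) 1 ∧
    1 / 9 * (1 - p.1 ^ 2) + 5 / 16 * p.1 ^ 2 - 3 / 16 * p.2 ^ 2 - 1 / 8 * p.1 * p.2 < 0}

/-- The upper constraint curve, from `(1, 1)` to `(-1, 5/3)`. -/
def upperCurve (h : ℝ) : ℝ := (4 * √(2 * h ^ 2 + 1) - √3 * h) / (3 * √3)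

/-- The lower constraint curve, from `(1, -5/3)` to `(-1, -1)`. -/
def lowerCurve (h : ℝ) : ℝ := -(4 * √(2 * h ^ 2 + 1) + √3 * h) / (3 * √3)

/-- The region `AF`. -/
def regionAF : Set (ℝ × ℝ) := {p ∈ stateSpace | upperCurve p.1 < p.2}

/-- The region `CD`. -/
def regionCD : Set (ℝ × ℝ) := {p ∈ stateSpace | p.2 < lowerCurve p.1}

/-- The vector field of the expansion-normalised system, i.e. of the evolution equations of
`H/√|Λ|` and `σ/√|Λ|` in the variables `(H_N, σ_N)` and the time `τ_N` with `dt/dτ_N = 1/N`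
(in units with `|Λ| = 1`). -/
def normalisedField (p : ℝ × ℝ) : ℝ × ℝ :=
  let q := -(9 / 8) * (p.2 ^ 2 + p.1 ^ 2) - 3 / 4 * p.1 * p.2 - 1 / 3 * (1 - p.1 ^ 2)
  ((1 - p.1 ^ 2) * q,
    9 / 8 * p.2 ^ 2 - 9 / 4 * p.1 * p.2 - 1 / 3 * (1 - p.1 ^ 2) - 15 / 8 * p.1 ^ 2 - p.2 * p.1 * q)

/-- Invariance under the flow of the expansion-normalised system: an orbit that meets `A` stays
in `A`, to the past and to the future, for as long as it exists. -/
def IsFlowInvariant (A : Set (ℝ × ℝ)) : Prop :=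
  ∀ (J : Set ℝ) (γ : ℝ → ℝ × ℝ), IsOpen J → J.OrdConnected →
    (∀ τ ∈ J, HasDerivAt γ (normalisedField (γ τ)) τ) →
    ∀ τ₀ ∈ J, γ τ₀ ∈ A → ∀ τ ∈ J, γ τ ∈ A

/-! ### Asymptotic behaviour

In the next two definitions `l` is `𝓝[<] T` (future) or `𝓝[>] T` (past). -/

/-- As `t → T` the scale factors are asymptotic to a pancake solution
`a = A cos (√|Λ| (c + t))`, `b = B`, with a zero of `a` at `t = T`. -/
def IsAsymptoticToPancake (Λ T : ℝ) (l : Filter ℝ) (a b : ℝ → ℝ) : Prop :=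
  ∃ A B c : ℝ, 0 < A ∧ 0 < B ∧ Real.cos (√|Λ| * (c + T)) = 0 ∧
    (∀ᶠ t in l, 0 < Real.cos (√|Λ| * (c + t))) ∧
    a ~[l] (fun t => A * Real.cos (√|Λ| * (c + t))) ∧
    Tendsto b l (𝓝 B)

/-- As `t → T` the scale factors are asymptotic to
`a = A cos (√|Λ| (c + t)) ^ (-1/3)`, `b = B cos (√|Λ| (c + t)) ^ (2/3)`, with a zero of the cosine
at `t = T`. -/
def IsAsymptoticToKasner (Λ T : ℝ) (l : Filter ℝ) (a b : ℝ → ℝ) : Prop :=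
  ∃ A B c : ℝ, 0 < A ∧ 0 < B ∧ Real.cos (√|Λ| * (c + T)) = 0 ∧
    (∀ᶠ t in l, 0 < Real.cos (√|Λ| * (c + t))) ∧
    a ~[l] (fun t => A * Real.cos (√|Λ| * (c + t)) ^ (-(1 / 3) : ℝ)) ∧
    b ~[l] (fun t => B * Real.cos (√|Λ| * (c + t)) ^ (2 / 3 : ℝ))

end

end KantowskiSachs

open KantowskiSachs

/-! The equations integrate to one autonomous first-order equation for b. The constraint reads
2(a'/a)(b'/b) = -(|Λ| + 1/b² + (b'/b)²) < 0, so b' never vanishes and a', b' have opposite signs; by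
time reversal the case b' > 0 suffices. Eliminating between the constraint and the evolution
equation of b gives b'' = (a'/a) b', hence a = k b' (`IsSolution.exists_a_eq`), and 2 b b'' = -(b'²
+ 1 + |Λ| b²), hence conservation of M = b b'² + b + |Λ| b³/3 (`IsSolution.exists_mass`). Thus b' =
√(`profile` |Λ| M b / b), as in the interior of a Schwarzschild–anti-de Sitter black hole.

Inverting the quadrature for this equation produces a solution along which b sweeps out (0, R), with
R the root of the profile. It extends the given one, so by maximality b itself runs from 0 to R
(`IsMaximalSolution.image_b`). The ends can then be read off. As b → 0, √b b' → √M, so b^(3/2)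
vanishes linearly in t and a behaves like b^(-1/2): a Kasner end. As b → R, b' → 0 while b'' has a
negative limit, so a = k b' has a simple zero and b stays positive: a pancake end.

A Riccati inequality for b'/b bounds the interval of existence, and with it the affine length of
timelike geodesics. The invariance of the two regions is independent of all this: the functions
defining the state space solve linear homogeneous equations along the flow, and AF and CD are told
apart by the sign of s + h/3, which cannot vanish there. -/

namespace KantowskiSachs

/-! ### Scalar equations on an interval -/

/-- A continuous function on an open interval has a primitive. -/
theorem exists_primitive {J : Set ℝ} (hJ : IsOpen J) (hJc : J.OrdConnected) {g : ℝ → ℝ}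
    (hg : ContinuousOn g J) : ∃ G : ℝ → ℝ, ∀ x ∈ J, HasDerivAt G (g x) x := by
  rcases J.eq_empty_or_nonempty with rfl | ⟨x₀, hx₀⟩
  · exact ⟨0, fun x hx => hx.elim⟩
  · refine ⟨fun x => ∫ u in x₀..x, g u, fun x hx => ?_⟩
    refine intervalIntegral.integral_hasDerivAt_right ?_ ?_ (hg.continuousAt (hJ.mem_nhds hx))
    · exact (hg.mono (hJc.uIcc_subset hx₀ hx)).intervalIntegrable
    · exact hg.stronglyMeasurableAtFilter hJ x hx

/-- On an open interval a function with vanishing derivative is constant. -/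
theorem eq_of_hasDerivAt_zero {J : Set ℝ} (hJ : IsOpen J) (hJc : J.OrdConnected) {f : ℝ → ℝ}
    (hf : ∀ x ∈ J, HasDerivAt f 0 x) {x y : ℝ} (hx : x ∈ J) (hy : y ∈ J) : f x = f y :=
  hJ.is_const_of_deriv_eq_zero hJc.isPreconnected
    (fun z hz => (hf z hz).differentiableAt.differentiableWithinAt)
    (fun z hz => (hf z hz).deriv) hx hy

/-- Solutions of a scalar linear homogeneous equation keep their sign. -/
theorem linear_ode_sign {J : Set ℝ} (hJ : IsOpen J) (hJc : J.OrdConnected) {f g : ℝ → ℝ}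
    (hg : ContinuousOn g J) (hf : ∀ x ∈ J, HasDerivAt f (g x * f x) x) {x y : ℝ}
    (hx : x ∈ J) (hy : y ∈ J) : ∃ c : ℝ, 0 < c ∧ f y = c * f x := by
  obtain ⟨G, hG⟩ := exists_primitive hJ hJc hg
  have key : ∀ z ∈ J, HasDerivAt (fun z => f z * Real.exp (-G z)) 0 z := by
    intro z hz
    refine ((hf z hz).mul ((hG z hz).neg.exp)).congr_deriv ?_
    ring
  have h := eq_of_hasDerivAt_zero hJ hJc key hx hy
  refine ⟨Real.exp (G y) * Real.exp (-G x), by positivity, ?_⟩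
  have h1 : Real.exp (-G y) * Real.exp (G y) = 1 := by rw [← Real.exp_add]; simp
  calc f y = f y * (Real.exp (-G y) * Real.exp (G y)) := by rw [h1, mul_one]
    _ = (f y * Real.exp (-G y)) * Real.exp (G y) := by ring
    _ = _ := by rw [← h]; ring

/-- A continuous function without zeros on an interval keeps its sign. -/
theorem pos_of_ne_zero {J : Set ℝ} (hJc : J.OrdConnected) {f : ℝ → ℝ}
    (hf : ContinuousOn f J) (h0 : ∀ x ∈ J, f x ≠ 0) {x y : ℝ} (hx : x ∈ J) (hy : y ∈ J)
    (hpos : 0 < f x) : 0 < f y := by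
  by_contra hneg
  obtain ⟨z, hz, hz0⟩ := hJc.isPreconnected.intermediate_value hy hx hf
    (show (0 : ℝ) ∈ Icc (f y) (f x) from ⟨not_lt.1 hneg, hpos.le⟩)
  exact h0 z hz hz0

/-! ### The state space -/

/-- The quadratic form of the constraint. -/
noncomputable def constraintForm (p : ℝ × ℝ) : ℝ :=
  1 / 9 * (1 - p.1 ^ 2) + 5 / 16 * p.1 ^ 2 - 3 / 16 * p.2 ^ 2 - 1 / 8 * p.1 * p.2

/-- Half of the distance of the upper and the lower constraint curve. -/
noncomputable def curveGap (h : ℝ) : ℝ := 4 * √(2 * h ^ 2 + 1) / (3 * √3)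

theorem curveGap_pos (h : ℝ) : 0 < curveGap h := by unfold curveGap; positivity

theorem curveGap_sq (h : ℝ) : curveGap h ^ 2 = 16 / 27 * (2 * h ^ 2 + 1) := by
  unfold curveGap
  rw [div_pow, mul_pow, mul_pow, Real.sq_sqrt (by positivity), Real.sq_sqrt (by positivity)]
  ring

theorem upperCurve_eq (h : ℝ) : upperCurve h = curveGap h - h / 3 := by
  unfold upperCurve curveGap
  field_simp

theorem lowerCurve_eq (h : ℝ) : lowerCurve h = -curveGap h - h / 3 := by
  unfold lowerCurve curveGap
  field_simp
  ring

/-- Completing the square in the second variable. The state space is thereby |s + h/3| > `curveGap`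
h > 0, and the two signs of s + h/3 give its two components. -/
theorem constraintForm_eq (p : ℝ × ℝ) :
    constraintForm p = 3 / 16 * (curveGap p.1 ^ 2 - (p.2 + p.1 / 3) ^ 2) := by
  rw [curveGap_sq, constraintForm]
  ring

theorem mem_stateSpace {p : ℝ × ℝ} :
    p ∈ stateSpace ↔ p.1 ∈ Icc (-1) 1 ∧ constraintForm p < 0 := Iff.rfl

theorem constraintForm_neg_iff (p : ℝ × ℝ) :
    constraintForm p < 0 ↔ curveGap p.1 < |p.2 + p.1 / 3| := by
  have key := sq_lt_sq (a := curveGap p.1) (b := p.2 + p.1 / 3)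
  rw [abs_of_pos (curveGap_pos p.1)] at key
  rw [constraintForm_eq, ← key]
  constructor <;> intro h <;> linarith

theorem mem_regionAF {p : ℝ × ℝ} :
    p ∈ regionAF ↔ p ∈ stateSpace ∧ 0 < p.2 + p.1 / 3 := by
  refine and_congr_right fun hp => ?_
  have h := (constraintForm_neg_iff p).1 hp.2
  have hg := curveGap_pos p.1
  rw [upperCurve_eq]
  constructor
  · intro h'; linarith
  · intro h'; rw [abs_of_pos h'] at h; linarith

theorem mem_regionCD {p : ℝ × ℝ} :
    p ∈ regionCD ↔ p ∈ stateSpace ∧ p.2 + p.1 / 3 < 0 := by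
  refine and_congr_right fun hp => ?_
  have h := (constraintForm_neg_iff p).1 hp.2
  have hg := curveGap_pos p.1
  rw [lowerCurve_eq]
  constructor
  · intro h'; linarith
  · intro h'; rw [abs_of_neg h'] at h; linarith

theorem ne_zero_of_mem_stateSpace {p : ℝ × ℝ} (hp : p ∈ stateSpace) : p.2 + p.1 / 3 ≠ 0 := by
  intro h0
  have h := (constraintForm_neg_iff p).1 hp.2
  rw [h0, abs_zero] at h
  exact (curveGap_pos p.1).not_gt h

theorem regionAF_union_regionCD : regionAF ∪ regionCD = stateSpace := by
  ext p
  rw [mem_union, mem_regionAF, mem_regionCD, ← and_or_left]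
  exact ⟨fun h => h.1, fun h => ⟨h, (ne_zero_of_mem_stateSpace h).symm.lt_or_gt⟩⟩

theorem disjoint_regionAF_regionCD : Disjoint regionAF regionCD :=
  Set.disjoint_left.2 fun _ h h' => lt_asymm (mem_regionAF.1 h).2 (mem_regionCD.1 h').2

/-- Along an orbit each of 1 + h, 1 - h and the constraint form satisfies an equation f' = g f with
continuous g, so `linear_ode_sign` preserves the inequalities, including the non-strict ones at h =
±1. -/
theorem isFlowInvariant_stateSpace : IsFlowInvariant stateSpace := by
  intro J γ hJ hJc hγ τ₀ hτ₀ h0 τ hτ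
  have hfst : ∀ u ∈ J, HasDerivAt (fun u => (γ u).1) (normalisedField (γ u)).1 u := fun u hu =>
    (hasFDerivAt_fst (𝕜 := ℝ) (E := ℝ) (F := ℝ)).comp_hasDerivAt u (hγ u hu)
  have hsnd : ∀ u ∈ J, HasDerivAt (fun u => (γ u).2) (normalisedField (γ u)).2 u := fun u hu =>
    (hasFDerivAt_snd (𝕜 := ℝ) (E := ℝ) (F := ℝ)).comp_hasDerivAt u (hγ u hu)
  have hc1 : ContinuousOn (fun u => (γ u).1) J :=
    fun u hu => (hfst u hu).continuousAt.continuousWithinAt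
  have hc2 : ContinuousOn (fun u => (γ u).2) J :=
    fun u hu => (hsnd u hu).continuousAt.continuousWithinAt
  let q : ℝ → ℝ := fun u => -(9 / 8) * ((γ u).2 ^ 2 + (γ u).1 ^ 2) - 3 / 4 * (γ u).1 * (γ u).2
    - 1 / 3 * (1 - (γ u).1 ^ 2)
  have hq : ContinuousOn q J := by fun_prop
  obtain ⟨⟨hl, hr⟩, hQ⟩ := mem_stateSpace.1 h0
  refine mem_stateSpace.2 ⟨⟨?_, ?_⟩, ?_⟩
  · obtain ⟨c, hc, h⟩ := linear_ode_sign hJ hJc (f := fun u => 1 + (γ u).1)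
      (g := fun u => (1 - (γ u).1) * q u) (by fun_prop)
      (fun u hu => ((hfst u hu).const_add 1).congr_deriv (by simp only [normalisedField, q]; ring))
      hτ₀ hτ
    have : 0 ≤ c * (1 + (γ τ₀).1) := mul_nonneg hc.le (by linarith)
    linarith
  · obtain ⟨c, hc, h⟩ := linear_ode_sign hJ hJc (f := fun u => 1 - (γ u).1)
      (g := fun u => -(1 + (γ u).1) * q u) (by fun_prop)
      (fun u hu => ((hfst u hu).const_sub 1).congr_deriv (by simp only [normalisedField, q]; ring))
      hτ₀ hτ
    have : 0 ≤ c * (1 - (γ τ₀).1) := mul_nonneg hc.le (by linarith)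
    linarith
  · obtain ⟨c, hc, h⟩ := linear_ode_sign hJ hJc (f := fun u => constraintForm (γ u))
      (g := fun u => -(3 / 2) * ((γ u).1 - (γ u).2) - 2 * (γ u).1 * q u) (by fun_prop)
      (fun u hu => by
        have h1 := hfst u hu
        have h2 := hsnd u hu
        have h3 := (((((h1.pow 2).const_sub 1).const_mul (1 / 9)).add
          ((h1.pow 2).const_mul (5 / 16))).sub ((h2.pow 2).const_mul (3 / 16))).sub
          ((h1.const_mul (1 / 8)).mul h2)
        refine h3.congr_deriv ?_
        simp only [normalisedField, q, constraintForm]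
        ring)
      hτ₀ hτ
    rw [h]
    exact mul_neg_of_pos_of_neg hc hQ

theorem continuousOn_snd_add {J : Set ℝ} {γ : ℝ → ℝ × ℝ}
    (hγ : ∀ τ ∈ J, HasDerivAt γ (normalisedField (γ τ)) τ) :
    ContinuousOn (fun u => (γ u).2 + (γ u).1 / 3) J := by
  have hc : ContinuousOn γ J := fun u hu => (hγ u hu).continuousAt.continuousWithinAt
  fun_prop

theorem isFlowInvariant_regionAF : IsFlowInvariant regionAF := by
  intro J γ hJ hJc hγ τ₀ hτ₀ h0 τ hτ
  have hS : ∀ u ∈ J, γ u ∈ stateSpace :=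
    isFlowInvariant_stateSpace J γ hJ hJc hγ τ₀ hτ₀ h0.1
  exact mem_regionAF.2 ⟨hS τ hτ, pos_of_ne_zero hJc (continuousOn_snd_add hγ)
    (fun u hu => ne_zero_of_mem_stateSpace (hS u hu)) hτ₀ hτ (mem_regionAF.1 h0).2⟩

theorem isFlowInvariant_regionCD : IsFlowInvariant regionCD := by
  intro J γ hJ hJc hγ τ₀ hτ₀ h0 τ hτ
  have hS : ∀ u ∈ J, γ u ∈ stateSpace :=
    isFlowInvariant_stateSpace J γ hJ hJc hγ τ₀ hτ₀ h0.1
  refine mem_regionCD.2 ⟨hS τ hτ, neg_pos.1 (pos_of_ne_zero hJc (continuousOn_snd_add hγ).neg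
    (fun u hu => neg_ne_zero.2 (ne_zero_of_mem_stateSpace (hS u hu))) hτ₀ hτ
    (neg_pos.2 (mem_regionCD.1 h0).2))⟩

/-! ### Timelike geodesics -/

/-- The Lorentzian norm of the tangent vector of a geodesic is constant. -/
theorem IsTimelikeGeodesic.hasDerivAt_norm {I J : Set ℝ} {a b t z : ℝ → ℝ}
    {x : ℝ → EuclideanSpace ℝ (Fin 3)} (h : IsTimelikeGeodesic I a b J t z x)
    (ha : ∀ t ∈ I, a t ≠ 0 ∧ DifferentiableAt ℝ a t)
    (hb : ∀ t ∈ I, b t ≠ 0 ∧ DifferentiableAt ℝ b t) {s : ℝ} (hs : s ∈ J) :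
    HasDerivAt (fun s => -(deriv t s) ^ 2 + a (t s) ^ 2 * deriv z s ^ 2
      + b (t s) ^ 2 * ‖deriv x s‖ ^ 2) 0 s := by
  have ht := (h.t_diff s hs).1.hasDerivAt
  have ht2 := (h.t_diff s hs).2.hasDerivAt
  have hz2 := (h.z_diff s hs).2.hasDerivAt
  have hx := (h.x_diff s hs).1.hasDerivAt
  have hx2 := (h.x_diff s hs).2.hasDerivAt
  have hA := (ha _ (h.mem s hs)).2.hasDerivAt.comp s ht
  have hB := (hb _ (h.mem s hs)).2.hasDerivAt.comp s ht
  have ha0 := (ha _ (h.mem s hs)).1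
  have hb0 := (hb _ (h.mem s hs)).1
  -- Differentiating ‖x‖² = 1; it removes the normal term ‖x'‖² x from the inner product of the
  -- acceleration with x'.
  have horth : inner ℝ (x s) (deriv x s) = 0 := by
    have h1 : HasDerivAt (fun s => ‖x s‖ ^ 2) (2 * inner ℝ (x s) (deriv x s)) s := hx.norm_sq
    have h2 : HasDerivAt (fun s => ‖x s‖ ^ 2) 0 s := by
      refine (hasDerivAt_const s (1 : ℝ)).congr_of_eventuallyEq ?_
      filter_upwards [h.isOpen.mem_nhds hs] with u hu
      rw [h.sphere u hu]; norm_num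
    linarith [h1.unique h2]
  have hacc : inner ℝ (deriv x s) (deriv (deriv x) s)
      = -(2 * (deriv b (t s) / b (t s)) * deriv t s) * ‖deriv x s‖ ^ 2 := by
    have h1 := congrArg (fun v => inner ℝ (deriv x s) v) (h.geodesic_x s hs)
    simp only [inner_add_right, inner_smul_right, inner_zero_right, real_inner_self_eq_norm_sq,
      real_inner_comm, horth] at h1
    linarith
  refine (((ht2.pow 2).neg.add ((hA.pow 2).mul (hz2.pow 2))).add
    ((hB.pow 2).mul hx2.norm_sq)).congr_deriv ?_
  have e1 : deriv (deriv t) s = -(a (t s) * deriv a (t s) * deriv z s ^ 2)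
      - b (t s) * deriv b (t s) * ‖deriv x s‖ ^ 2 := by linarith [h.geodesic_t s hs]
  have e2 : deriv (deriv z) s = -(2 * (deriv a (t s) / a (t s)) * deriv t s * deriv z s) := by
    linarith [h.geodesic_z s hs]
  rw [hacc, e1, e2]
  simp only [Function.comp_apply, Pi.pow_apply]
  field_simp
  ring

/-- The conserved norm of the tangent vector is -c² with c > 0, and the spatial terms are
nonnegative, so |dt/ds| ≥ c. As t stays in [m, M], the mean value theorem bounds the affine length
by (M - m)/c. -/
theorem recollapses_of_isBounded {I : Set ℝ} {a b : ℝ → ℝ} (hI : BddBelow I ∧ BddAbove I)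
    (ha : ∀ t ∈ I, a t ≠ 0 ∧ DifferentiableAt ℝ a t)
    (hb : ∀ t ∈ I, b t ≠ 0 ∧ DifferentiableAt ℝ b t) : Recollapses I a b := by
  intro J t z x h
  rcases J.eq_empty_or_nonempty with rfl | ⟨s₀, hs₀⟩
  · exact ⟨bddBelow_empty, bddAbove_empty⟩
  obtain ⟨⟨m, hm⟩, ⟨M, hM⟩⟩ := hI
  set E : ℝ → ℝ := fun s => -(deriv t s) ^ 2 + a (t s) ^ 2 * deriv z s ^ 2
      + b (t s) ^ 2 * ‖deriv x s‖ ^ 2 with hE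
  have hE0 : E s₀ < 0 := h.timelike s₀ hs₀
  set c := √(-E s₀) with hc
  have hcpos : 0 < c := Real.sqrt_pos.2 (by linarith)
  have hsq : ∀ s ∈ J, c ≤ |deriv t s| := by
    intro s hs
    have : E s₀ = E s := eq_of_hasDerivAt_zero h.isOpen h.ordConnected
      (fun u hu => h.hasDerivAt_norm ha hb hu) hs₀ hs
    rw [hc, this]
    refine Real.sqrt_le_iff.2 ⟨abs_nonneg _, ?_⟩
    rw [sq_abs, hE]
    have h1 : 0 ≤ a (t s) ^ 2 * deriv z s ^ 2 := by positivity
    have h2 : 0 ≤ b (t s) ^ 2 * ‖deriv x s‖ ^ 2 := by positivity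
    simp only
    linarith
  have key : ∀ s ∈ J, ∀ u ∈ J, s ≤ u → u - s ≤ (M - m) / c := by
    intro s hs u hu hsu
    rcases hsu.eq_or_lt with rfl | hlt
    · have : m ≤ M := (hm (h.mem _ hs)).trans (hM (h.mem _ hs))
      rw [sub_self]
      exact div_nonneg (by linarith) hcpos.le
    have hsub : Icc s u ⊆ J := h.ordConnected.out hs hu
    obtain ⟨v, hv, hvd⟩ := exists_deriv_eq_slope t hlt
      (fun w hw => (h.t_diff w (hsub hw)).1.continuousAt.continuousWithinAt)
      (fun w hw => (h.t_diff w (hsub (Ioo_subset_Icc_self hw))).1.differentiableWithinAt)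
    have h1 := hsq v (hsub (Ioo_subset_Icc_self hv))
    have hpos : 0 < u - s := by linarith
    rw [hvd, abs_div, abs_of_pos hpos, le_div_iff₀ hpos] at h1
    rw [le_div_iff₀ hcpos, mul_comm]
    refine h1.trans (abs_le.2 ⟨?_, ?_⟩) <;>
      linarith [hm (h.mem s hs), hM (h.mem s hs), hm (h.mem u hu), hM (h.mem u hu)]
  have hnn : 0 ≤ (M - m) / c := by simpa using key s₀ hs₀ s₀ hs₀ le_rfl
  refine ⟨⟨s₀ - (M - m) / c, fun s hs => ?_⟩, ⟨s₀ + (M - m) / c, fun s hs => ?_⟩⟩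
  · rcases le_total s s₀ with h' | h'
    · linarith [key s hs s₀ hs₀ h']
    · linarith
  · rcases le_total s s₀ with h' | h'
    · linarith
    · linarith [key s₀ hs₀ s hs h']

/-! ### First integrals -/

section Solution

variable {Λ : ℝ} {I : Set ℝ} {a b : ℝ → ℝ}

/-- The right-hand side is strictly negative: this rules out zeros of b' and forces a' and b' to
have opposite signs. -/
theorem IsSolution.two_mul_deriv_mul_deriv (h : IsSolution Λ I a b) {t : ℝ} (ht : t ∈ I) :
    2 * (deriv a t / a t) * (deriv b t / b t)
      = -(|Λ| + 1 / b t ^ 2 + (deriv b t / b t) ^ 2) := by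
  have h1 := h.constraint t ht
  have ha := (h.a_pos t ht).ne'
  have hb := (h.b_pos t ht).ne'
  have h2 : 2 * (deriv a t / a t) * (deriv b t / b t)
      = 2 * (deriv b t * deriv a t / (b t * a t)) := by field_simp
  rw [h2, div_pow]
  linarith

theorem IsSolution.deriv_b_ne_zero (h : IsSolution Λ I a b) (hΛ : Λ < 0) {t : ℝ} (ht : t ∈ I) :
    deriv b t ≠ 0 := by
  intro h0
  have h1 := h.two_mul_deriv_mul_deriv ht
  have h2 : 0 < 1 / b t ^ 2 := by have := h.b_pos t ht; positivity
  rw [h0] at h1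
  simp only [zero_div, mul_zero] at h1
  have := abs_pos.2 hΛ.ne
  nlinarith

/-- The constraint replaces all terms of the evolution equation other than the mixed one by twice
the mixed term. It says that a and b' have the same logarithmic derivative. -/
theorem IsSolution.deriv_deriv_b (h : IsSolution Λ I a b) {t : ℝ} (ht : t ∈ I) :
    deriv (deriv b) t = deriv a t / a t * deriv b t := by
  have h1 := h.two_mul_deriv_mul_deriv ht
  have ha := (h.a_pos t ht).ne'
  have hb := (h.b_pos t ht).ne'
  rw [h.evolution_b t ht]
  field_simp at h1 ⊢
  nlinarith

theorem IsSolution.continuousOn_deriv_b (h : IsSolution Λ I a b) : ContinuousOn (deriv b) I :=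
  fun t ht => (h.b_diff_two t ht).continuousAt.continuousWithinAt

theorem IsSolution.continuousOn_deriv_a (h : IsSolution Λ I a b) : ContinuousOn (deriv a) I :=
  fun t ht => (h.a_diff_two t ht).continuousAt.continuousWithinAt

theorem IsSolution.continuousOn_a (h : IsSolution Λ I a b) : ContinuousOn a I :=
  fun t ht => (h.a_diff t ht).continuousAt.continuousWithinAt

theorem IsSolution.continuousOn_b (h : IsSolution Λ I a b) : ContinuousOn b I :=
  fun t ht => (h.b_diff t ht).continuousAt.continuousWithinAt

/-- Here a has dropped out. This closed equation for b yields both the mass integral and the Riccati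
inequality. -/
theorem IsSolution.two_mul_b_deriv_deriv_b (h : IsSolution Λ I a b) {t : ℝ} (ht : t ∈ I) :
    2 * b t * deriv (deriv b) t = -(deriv b t ^ 2 + 1 + |Λ| * b t ^ 2) := by
  have h1 := h.two_mul_deriv_mul_deriv ht
  have ha := (h.a_pos t ht).ne'
  have hb := (h.b_pos t ht).ne'
  rw [h.deriv_deriv_b ht]
  field_simp at h1 ⊢
  nlinarith

/-- `a` is proportional to `b'`. -/
theorem IsSolution.exists_a_eq (h : IsSolution Λ I a b) (hpos : ∀ t ∈ I, 0 < deriv b t) :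
    ∃ k : ℝ, 0 < k ∧ ∀ t ∈ I, a t = k * deriv b t := by
  obtain ⟨t₀, ht₀⟩ := h.nonempty
  have key : ∀ t ∈ I, HasDerivAt (fun t => a t / deriv b t) 0 t := by
    intro t ht
    have ha := (h.a_pos t ht).ne'
    have hb := (hpos t ht).ne'
    refine ((h.a_diff t ht).hasDerivAt.div (h.b_diff_two t ht).hasDerivAt hb).congr_deriv ?_
    rw [h.deriv_deriv_b ht]
    field_simp
    ring
  refine ⟨a t₀ / deriv b t₀, div_pos (h.a_pos t₀ ht₀) (hpos t₀ ht₀), fun t ht => ?_⟩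
  have h1 : a t₀ / deriv b t₀ = a t / deriv b t :=
    eq_of_hasDerivAt_zero h.isOpen h.ordConnected key ht₀ ht
  rw [h1, div_mul_cancel₀ _ (hpos t ht).ne']

/-- The function `M - r - l r³ / 3`, which equals `b b'²` along solutions. -/
noncomputable def profile (l M r : ℝ) : ℝ := M - r - l / 3 * r ^ 3

/-- The mass is a first integral. -/
theorem IsSolution.exists_mass (h : IsSolution Λ I a b) :
    ∃ M : ℝ, 0 < M ∧ ∀ t ∈ I, b t * deriv b t ^ 2 = profile |Λ| M (b t) := by
  obtain ⟨t₀, ht₀⟩ := h.nonempty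
  have key : ∀ t ∈ I, HasDerivAt
      (fun t => b t * deriv b t ^ 2 + b t + |Λ| / 3 * b t ^ 3) 0 t := by
    intro t ht
    have hb := (h.b_diff t ht).hasDerivAt
    have hb2 := (h.b_diff_two t ht).hasDerivAt
    refine (((hb.mul (hb2.pow 2)).add hb).add ((hb.pow 3).const_mul (|Λ| / 3))).congr_deriv ?_
    have h1 := h.two_mul_b_deriv_deriv_b ht
    simp only [Pi.pow_apply]
    linear_combination (deriv b t) * h1
  refine ⟨b t₀ * deriv b t₀ ^ 2 + b t₀ + |Λ| / 3 * b t₀ ^ 3, ?_, fun t ht => ?_⟩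
  · have := h.b_pos t₀ ht₀
    positivity
  · have h1 : b t₀ * deriv b t₀ ^ 2 + b t₀ + |Λ| / 3 * b t₀ ^ 3
      = b t * deriv b t ^ 2 + b t + |Λ| / 3 * b t ^ 3 :=
      eq_of_hasDerivAt_zero h.isOpen h.ordConnected key ht₀ ht
    rw [h1, profile]
    ring

/-- The interval of existence is bounded, by the Riccati inequality for `b' / b`. -/
theorem IsSolution.isBounded (h : IsSolution Λ I a b) (hΛ : Λ < 0) :
    BddBelow I ∧ BddAbove I := by
  obtain ⟨t₀, ht₀⟩ := h.nonempty
  have hl : 0 < |Λ| := abs_pos.2 hΛ.ne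
  set w := √|Λ| with hw
  have hwpos : 0 < w := Real.sqrt_pos.2 hl
  have hw2 : w ^ 2 = |Λ| := Real.sq_sqrt hl.le
  -- With v = b'/b the equation for b gives v' ≤ -(v² + w²)/2, so arctan(v/w) decreases at rate at
  -- least w/2. Its range has length π, whence the bound 2π/w on the length of the interval.
  let f : ℝ → ℝ := fun t => Real.arctan (deriv b t / b t / w) + w / 2 * t
  have hf : ∀ t ∈ I, HasDerivAt f (1 / (1 + (deriv b t / b t / w) ^ 2) *
      ((deriv (deriv b) t * b t - deriv b t * deriv b t) / b t ^ 2 / w) + w / 2 * 1) t := by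
    intro t ht
    exact ((((h.b_diff_two t ht).hasDerivAt.div (h.b_diff t ht).hasDerivAt
      (h.b_pos t ht).ne').div_const w).arctan).add ((hasDerivAt_id t).const_mul (w / 2))
  have hanti : AntitoneOn f I := by
    refine antitoneOn_of_deriv_nonpos h.ordConnected.convex
      (fun t ht => (hf t ht).continuousAt.continuousWithinAt) ?_ ?_
    · intro t ht
      exact (hf t (interior_subset ht)).differentiableAt.differentiableWithinAt
    · intro t ht
      have ht := interior_subset ht
      rw [(hf t ht).deriv]
      have hb := h.b_pos t ht
      have h1 := h.two_mul_b_deriv_deriv_b ht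
      have h2 : 1 / (1 + (deriv b t / b t / w) ^ 2) *
          ((deriv (deriv b) t * b t - deriv b t * deriv b t) / b t ^ 2 / w) + w / 2 * 1
          = w * (2 * b t * deriv (deriv b) t - deriv b t ^ 2 + w ^ 2 * b t ^ 2)
            / (2 * (w ^ 2 * b t ^ 2 + deriv b t ^ 2)) := by
        field_simp
        ring
      rw [h2, h1, hw2]
      apply div_nonpos_of_nonpos_of_nonneg
      · apply mul_nonpos_of_nonneg_of_nonpos hwpos.le
        nlinarith [sq_nonneg (deriv b t)]
      · positivity
  have hbound : ∀ s ∈ I, ∀ u ∈ I, s ≤ u → u - s ≤ 2 * Real.pi / w := by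
    intro s hs u hu hsu
    have h1 := hanti hs hu hsu
    simp only [f] at h1
    have h2 := Real.neg_pi_div_two_lt_arctan (deriv b u / b u / w)
    have h3 := Real.arctan_lt_pi_div_two (deriv b s / b s / w)
    rw [le_div_iff₀ hwpos]
    nlinarith
  have hnn : 0 ≤ 2 * Real.pi / w := by positivity
  refine ⟨⟨t₀ - 2 * Real.pi / w, fun s hs => ?_⟩, ⟨t₀ + 2 * Real.pi / w, fun s hs => ?_⟩⟩
  · rcases le_total s t₀ with h' | h'
    · linarith [hbound s hs t₀ ht₀ h']
    · linarith
  · rcases le_total s t₀ with h' | h'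
    · linarith
    · linarith [hbound t₀ ht₀ s hs h']

theorem IsSolution.exists_eq_Ioo (h : IsSolution Λ I a b) (hΛ : Λ < 0) :
    ∃ T₁ T₂ : ℝ, T₁ < T₂ ∧ I = Ioo T₁ T₂ := by
  obtain ⟨hb, hB⟩ := h.isBounded hΛ
  have hI : I = Ioo (sInf I) (sSup I) := by
    refine Subset.antisymm (fun t ht => ?_)
      (IsConnected.Ioo_csInf_csSup_subset ⟨h.nonempty, h.ordConnected.isPreconnected⟩ hb hB)
    obtain ⟨ε, hε, hball⟩ := Metric.isOpen_iff.1 h.isOpen t ht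
    rw [Real.ball_eq_Ioo] at hball
    have h1 : t - ε / 2 ∈ I := hball ⟨by linarith, by linarith⟩
    have h2 : t + ε / 2 ∈ I := hball ⟨by linarith, by linarith⟩
    have h3 := csInf_le hb h1
    have h4 := le_csSup hB h2
    exact ⟨by linarith, by linarith⟩
  obtain ⟨t, ht⟩ := h.nonempty
  rw [hI] at ht
  exact ⟨_, _, ht.1.trans ht.2, hI⟩

end Solution

/-! ### The maximal interval -/

theorem hasDerivAt_profile (l M r : ℝ) : HasDerivAt (profile l M) (-1 - l * r ^ 2) r := by
  have h := ((hasDerivAt_id r).const_sub M).sub (((hasDerivAt_id r).pow 3).const_mul (l / 3))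
  refine h.congr_deriv ?_
  simp only [id]
  ring

theorem continuous_profile (l M : ℝ) : Continuous (profile l M) :=
  continuous_iff_continuousAt.2 fun r => (hasDerivAt_profile l M r).continuousAt

theorem strictAnti_profile {l : ℝ} (hl : 0 < l) (M : ℝ) : StrictAnti (profile l M) := by
  refine strictAnti_of_deriv_neg fun r => ?_
  rw [(hasDerivAt_profile l M r).deriv]
  nlinarith [mul_nonneg hl.le (sq_nonneg r)]

theorem exists_profile_root {l M : ℝ} (hl : 0 < l) (hM : 0 < M) :
    ∃ R : ℝ, 0 < R ∧ profile l M R = 0 ∧ ∀ r, 0 < profile l M r ↔ r < R := by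
  have h0 : profile l M 0 = M := by simp [profile]
  have h1 : profile l M M ≤ 0 := by
    have : 0 ≤ l / 3 * M ^ 3 := by positivity
    unfold profile
    linarith
  obtain ⟨R, hR, hR0⟩ := intermediate_value_Icc' hM.le (continuous_profile l M).continuousOn
    (show (0 : ℝ) ∈ Icc (profile l M M) (profile l M 0) from ⟨h1, by rw [h0]; exact hM.le⟩)
  refine ⟨R, ?_, hR0, fun r => ?_⟩
  · rcases hR.1.eq_or_lt with h | h
    · rw [← h, h0] at hR0
      exact absurd hR0 hM.ne'
    · exact h
  · rw [← hR0]
    exact (strictAnti_profile hl M).lt_iff_gt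

/-- The derivative of `b'` for a solution of `b'² = profile b / b`. -/
theorem hasDerivAt_sqrt_profile {l M : ℝ} {B : ℝ → ℝ} {t : ℝ} (hB : 0 < B t)
    (hp : 0 < profile l M (B t)) (hd : HasDerivAt B (√(profile l M (B t) / B t)) t) :
    HasDerivAt (fun t => √(profile l M (B t) / B t)) (-M / (2 * B t ^ 2) - l / 3 * B t) t := by
  have h1 := (((hasDerivAt_profile l M (B t)).comp t hd).div hd hB.ne').sqrt
    (div_pos hp hB).ne'
  refine h1.congr_deriv ?_
  have hs : 0 < √(profile l M (B t) / B t) := Real.sqrt_pos.2 (div_pos hp hB)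
  simp only [Function.comp_apply, Pi.div_apply]
  set s := √(profile l M (B t) / B t)
  unfold profile
  field_simp
  ring

/-- Converse of the two first integrals: a solution of the first-order equation, with a = k b',
solves the full system. It supplies the extension against which maximality is tested. -/
theorem isSolution_of_profile {Λ M k : ℝ} {J : Set ℝ} {B : ℝ → ℝ} (hk : 0 < k)
    (hJ : IsOpen J) (hJc : J.OrdConnected) (hJn : J.Nonempty) (hB : ∀ t ∈ J, 0 < B t)
    (hp : ∀ t ∈ J, 0 < profile |Λ| M (B t))
    (hd : ∀ t ∈ J, HasDerivAt B (√(profile |Λ| M (B t) / B t)) t) :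
    IsSolution Λ J (fun t => k * √(profile |Λ| M (B t) / B t)) B := by
  set s : ℝ → ℝ := fun t => √(profile |Λ| M (B t) / B t) with hs
  have hspos : ∀ t ∈ J, 0 < s t := fun t ht => Real.sqrt_pos.2 (div_pos (hp t ht) (hB t ht))
  have hssq : ∀ t ∈ J, s t ^ 2 = profile |Λ| M (B t) / B t := fun t ht =>
    Real.sq_sqrt (div_pos (hp t ht) (hB t ht)).le
  have hB' : ∀ t ∈ J, deriv B t = s t := fun t ht => (hd t ht).deriv
  have hB'e : ∀ t ∈ J, deriv B =ᶠ[𝓝 t] s := fun t ht => by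
    filter_upwards [hJ.mem_nhds ht] with u hu using hB' u hu
  have hds : ∀ t ∈ J, HasDerivAt s (-M / (2 * B t ^ 2) - |Λ| / 3 * B t) t := fun t ht =>
    hasDerivAt_sqrt_profile (hB t ht) (hp t ht) (hd t ht)
  have hB'' : ∀ t ∈ J, HasDerivAt (deriv B) (-M / (2 * B t ^ 2) - |Λ| / 3 * B t) t :=
    fun t ht => (hds t ht).congr_of_eventuallyEq (hB'e t ht)
  have hda : ∀ t ∈ J, HasDerivAt (fun t => k * s t)
      (k * (-M / (2 * B t ^ 2) - |Λ| / 3 * B t)) t := fun t ht => (hds t ht).const_mul k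
  have hda' : ∀ t ∈ J, deriv (fun t => k * s t) t = k * (-M / (2 * B t ^ 2) - |Λ| / 3 * B t) :=
    fun t ht => (hda t ht).deriv
  have hda'' : ∀ t ∈ J, HasDerivAt (deriv fun t => k * s t)
      (k * (M / B t ^ 3 - |Λ| / 3) * s t) t := by
    intro t ht
    have hBt := hB t ht
    have hd2 := ((((hd t ht).pow 2).const_mul 2).inv
      (mul_ne_zero two_ne_zero (pow_ne_zero 2 hBt.ne'))).const_mul (-M)
    have h1 := ((hd2.sub ((hd t ht).const_mul (|Λ| / 3))).const_mul k)
    refine (h1.congr_of_eventuallyEq ?_).congr_deriv ?_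
    · filter_upwards [hJ.mem_nhds ht] with u hu
      rw [hda' u hu]
      simp [div_eq_mul_inv]
    · have : √(profile |Λ| M (B t) / B t) = s t := rfl
      rw [this]
      simp only [Pi.pow_apply]
      field_simp
      ring
  refine ⟨hJ, hJc, hJn, fun t ht => mul_pos hk (hspos t ht), hB,
    fun t ht => (hda t ht).differentiableAt, fun t ht => (hd t ht).differentiableAt,
    fun t ht => (hda'' t ht).differentiableAt, fun t ht => (hB'' t ht).differentiableAt,
    fun t ht => ?_, fun t ht => ?_, fun t ht => ?_⟩
  all_goals
    have hBt := hB t ht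
    have hst := hspos t ht
    have hsq := hssq t ht
    have hroot : √(profile |Λ| M (B t) / B t) = s t := rfl
    unfold profile at hsq
    simp only [hroot]
  · rw [hda' t ht, (hB'' t ht).deriv, hB' t ht, hsq]
    field_simp
    ring
  · rw [hda' t ht, (hda'' t ht).deriv, hB' t ht]
    field_simp
    ring
  · rw [hda' t ht, hB' t ht, hsq]
    field_simp
    ring

/-- A function with positive derivative on `(0, R)` has a differentiable inverse, defined on an
open interval. -/
theorem exists_inverse_of_deriv_pos {R : ℝ} (hR : 0 < R) {G g : ℝ → ℝ}
    (hG : ∀ r ∈ Ioo 0 R, HasDerivAt G (g r) r) (hg : ∀ r ∈ Ioo 0 R, 0 < g r) :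
    ∃ B : ℝ → ℝ, IsOpen (G '' Ioo 0 R) ∧ (G '' Ioo 0 R).OrdConnected ∧
      (G '' Ioo 0 R).Nonempty ∧ StrictMonoOn B (G '' Ioo 0 R) ∧ B '' (G '' Ioo 0 R) = Ioo 0 R ∧
      (∀ r ∈ Ioo 0 R, B (G r) = r) ∧
      ∀ t ∈ G '' Ioo 0 R, B t ∈ Ioo 0 R ∧ HasDerivAt B (g (B t))⁻¹ t := by
  have hcont : ContinuousOn G (Ioo 0 R) := fun r hr => (hG r hr).continuousAt.continuousWithinAt
  have hmono : StrictMonoOn G (Ioo 0 R) := by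
    refine strictMonoOn_of_deriv_pos (convex_Ioo 0 R) hcont fun r hr => ?_
    rw [interior_Ioo] at hr
    rw [(hG r hr).deriv]
    exact hg r hr
  have hopen : IsOpen (G '' Ioo 0 R) := by
    -- Around G r the image contains the interval from G(r/2) to G((r + R)/2), by the intermediate
    -- value theorem and strict monotonicity.
    rw [isOpen_iff_mem_nhds]
    rintro _ ⟨r, hr, rfl⟩
    have h1 : r / 2 ∈ Ioo 0 R := ⟨by linarith [hr.1], by linarith [hr.1, hr.2]⟩
    have h2 : (r + R) / 2 ∈ Ioo 0 R := ⟨by linarith [hr.1], by linarith [hr.2]⟩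
    have hsub : Icc (r / 2) ((r + R) / 2) ⊆ Ioo 0 R := Icc_subset_Ioo h1.1 h2.2
    refine mem_of_superset (Icc_mem_nhds (hmono h1 hr (by linarith [hr.1]))
      (hmono hr h2 (by linarith [hr.2]))) ?_
    exact (intermediate_value_Icc (by linarith [hr.1, hr.2]) (hcont.mono hsub)).trans
      (image_mono hsub)
  set B := Function.invFunOn G (Ioo 0 R)
  have hBmem : ∀ t ∈ G '' Ioo 0 R, B t ∈ Ioo 0 R := fun t ht => Function.invFunOn_mem ht
  have hGB : ∀ t ∈ G '' Ioo 0 R, G (B t) = t := fun t ht => Function.invFunOn_eq ht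
  have hBG : ∀ r ∈ Ioo 0 R, B (G r) = r := fun r hr =>
    hmono.injOn (hBmem _ (mem_image_of_mem G hr)) hr (hGB _ (mem_image_of_mem G hr))
  have hBmono : StrictMonoOn B (G '' Ioo 0 R) := by
    intro s hs t ht hst
    rw [← hGB s hs, ← hGB t ht] at hst
    exact (hmono.lt_iff_lt (hBmem s hs) (hBmem t ht)).1 hst
  have himg : B '' (G '' Ioo 0 R) = Ioo 0 R := by
    ext r
    constructor
    · rintro ⟨t, ht, rfl⟩; exact hBmem t ht
    · exact fun hr => ⟨G r, mem_image_of_mem G hr, hBG r hr⟩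
  refine ⟨B, hopen, (isPreconnected_Ioo.image G hcont).ordConnected,
    ⟨_, mem_image_of_mem G (show R / 2 ∈ Ioo 0 R from ⟨by linarith, by linarith⟩)⟩, hBmono, himg,
    hBG, fun t ht => ⟨hBmem t ht, ?_⟩⟩
  have hBc : ContinuousAt B t := by
    refine hBmono.continuousAt_of_image_mem_nhds (hopen.mem_nhds ht) ?_
    rw [himg]
    exact isOpen_Ioo.mem_nhds (hBmem t ht)
  refine HasDerivAt.of_local_left_inverse hBc (hG _ (hBmem t ht)) (hg _ (hBmem t ht)).ne' ?_
  filter_upwards [hopen.mem_nhds ht] with u hu using hGB u hu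

/-- On a maximal solution with `b' > 0`, `b` increases from `0` to the root of the profile. -/
theorem IsMaximalSolution.image_b {Λ M R k : ℝ} {I : Set ℝ} {a b : ℝ → ℝ}
    (h : IsMaximalSolution Λ I a b) (hpos : ∀ t ∈ I, 0 < deriv b t) (hk : 0 < k)
    (ha : ∀ t ∈ I, a t = k * deriv b t)
    (hM : ∀ t ∈ I, b t * deriv b t ^ 2 = profile |Λ| M (b t)) (hR : 0 < R)
    (hRiff : ∀ r, 0 < profile |Λ| M r ↔ r < R) :
    StrictMonoOn b I ∧ b '' I = Ioo 0 R := by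
  obtain ⟨hsol, hmax⟩ := h
  obtain ⟨t₀, ht₀⟩ := hsol.nonempty
  have hbpos := hsol.b_pos
  have hppos : ∀ t ∈ I, 0 < profile |Λ| M (b t) := fun t ht => by
    rw [← hM t ht]
    exact mul_pos (hbpos t ht) (pow_pos (hpos t ht) 2)
  have hbmem : ∀ t ∈ I, b t ∈ Ioo 0 R := fun t ht => ⟨hbpos t ht, (hRiff _).1 (hppos t ht)⟩
  have hb' : ∀ t ∈ I, deriv b t = √(profile |Λ| M (b t) / b t) := fun t ht => by
    rw [← hM t ht, mul_div_cancel_left₀ _ (hbpos t ht).ne', Real.sqrt_sq (hpos t ht).le]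
  -- This is dt/db, so its primitive is time as a function of b.
  let g : ℝ → ℝ := fun r => (√(profile |Λ| M r / r))⁻¹
  have hgpos : ∀ r ∈ Ioo 0 R, 0 < √(profile |Λ| M r / r) := fun r hr =>
    Real.sqrt_pos.2 (div_pos ((hRiff r).2 hr.2) hr.1)
  have hgc : ContinuousOn g (Ioo 0 R) := by
    refine ContinuousOn.inv₀ ?_ fun r hr => (hgpos r hr).ne'
    exact ((continuous_profile |Λ| M).continuousOn.div continuousOn_id
      fun r hr => hr.1.ne').sqrt
  obtain ⟨G₀, hG₀⟩ := exists_primitive isOpen_Ioo ordConnected_Ioo hgc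
  -- The constant is fixed so that G (b t₀) = t₀, which makes G a left inverse of b on all of I.
  let G : ℝ → ℝ := fun r => G₀ r + (t₀ - G₀ (b t₀))
  have hG : ∀ r ∈ Ioo 0 R, HasDerivAt G (g r) r := fun r hr => (hG₀ r hr).add_const _
  have hGb : ∀ t ∈ I, G (b t) = t := by
    intro t ht
    have key : ∀ u ∈ I, HasDerivAt (fun u => G (b u) - u) 0 u := by
      intro u hu
      have h1 := ((hG _ (hbmem u hu)).comp u (hsol.b_diff u hu).hasDerivAt).sub (hasDerivAt_id u)
      refine h1.congr_deriv ?_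
      rw [hb' u hu]
      simp only [g]
      rw [inv_mul_cancel₀ (hgpos _ (hbmem u hu)).ne', sub_self]
    have h1 : G (b t) - t = G (b t₀) - t₀ :=
      eq_of_hasDerivAt_zero hsol.isOpen hsol.ordConnected key ht ht₀
    simp only [G] at h1 ⊢
    linarith
  obtain ⟨B, hopen, hconn, hne, hmono, himg, hBG, hB⟩ :=
    exists_inverse_of_deriv_pos hR hG fun r hr => inv_pos.2 (hgpos r hr)
  have hBb : EqOn B b I := fun t ht => by
    have := hBG _ (hbmem t ht)
    rwa [hGb t ht] at this
  have hsub : I ⊆ G '' Ioo 0 R := fun t ht => ⟨b t, hbmem t ht, hGb t ht⟩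
  -- The inverse of G agrees with b on I and solves the system on the possibly larger interval G((0,
  -- R)); maximality makes the intervals equal.
  have hJ : G '' Ioo 0 R = I := by
    refine hmax _ _ B (isSolution_of_profile hk hopen hconn hne (fun t ht => (hB t ht).1.1)
      (fun t ht => (hRiff _).2 (hB t ht).1.2) fun t ht => ?_) hsub ?_ hBb
    · have := (hB t ht).2
      simpa only [g, inv_inv] using this
    · intro t ht
      simp only
      rw [hBb ht, ha t ht, hb' t ht]
  rw [hJ] at hmono himg
  exact ⟨hmono.congr hBb, by rw [← himg, hBb.image_eq]⟩

/-! ### Limits of the expansion-normalised variables -/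

theorem tendsto_normalise_atTop {l : ℝ} :
    Tendsto (fun x : ℝ => x / (3 * √(l + x ^ 2 / 9))) atTop (𝓝 1) := by
  have h1 : Tendsto (fun x : ℝ => (√(9 * l * x⁻¹ ^ 2 + 1))⁻¹) atTop (𝓝 1) := by
    have h2 : Tendsto (fun y : ℝ => (√(9 * l * y ^ 2 + 1))⁻¹) (𝓝 0) (𝓝 1) := by
      have : ContinuousAt (fun y : ℝ => (√(9 * l * y ^ 2 + 1))⁻¹) 0 := by
        refine ContinuousAt.inv₀ (by fun_prop) (by simp)
      simpa [ContinuousAt] using this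
    exact h2.comp tendsto_inv_atTop_zero
  refine h1.congr' ?_
  filter_upwards [eventually_gt_atTop 0] with x hx
  have h3 : l + x ^ 2 / 9 = (x / 3) ^ 2 * (9 * l * x⁻¹ ^ 2 + 1) := by
    field_simp
    ring
  rw [h3, Real.sqrt_mul (sq_nonneg _), Real.sqrt_sq (by positivity)]
  field_simp

theorem tendsto_normalise_atBot {l : ℝ} :
    Tendsto (fun x : ℝ => x / (3 * √(l + x ^ 2 / 9))) atBot (𝓝 (-1)) := by
  have h := ((tendsto_normalise_atTop (l := l)).comp tendsto_neg_atBot_atTop).neg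
  refine h.congr fun x => ?_
  simp only [Function.comp_apply, neg_sq, neg_div, neg_neg]

/-- The second coordinate is the ratio of shear to mean curvature times the first, so the limit of
this ratio and the sign of the diverging mean curvature determine the limit point. -/
theorem tendsto_statePoint_of_normalise {Λ ρ ε : ℝ} {a b : ℝ → ℝ} {F : Filter ℝ}
    (hH0 : ∀ᶠ t in F, meanCurvature a b t ≠ 0)
    (hH : Tendsto (fun t => meanCurvature a b t / (3 * √(|Λ| + meanCurvature a b t ^ 2 / 9))) F
      (𝓝 ε))
    (hr : Tendsto (fun t => shear a b t / meanCurvature a b t) F (𝓝 ρ)) :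
    Tendsto (statePoint Λ a b) F (𝓝 (ε, ρ * ε)) := by
  refine hH.prodMk_nhds ((hr.mul hH).congr' ?_)
  filter_upwards [hH0] with t ht
  field_simp

section Limits

variable {Λ : ℝ} {a b u : ℝ → ℝ} {F : Filter ℝ} {x y : ℝ}

/-- The function u > 0 tends to zero and sets the scale: H behaves like (x + 2y)/u, and u cancels in
the ratio of shear to mean curvature. -/
theorem tendsto_meanCurvature_aux (hu : Tendsto u F (𝓝[>] 0))
    (hα : Tendsto (fun t => u t * (deriv a t / a t)) F (𝓝 x))
    (hβ : Tendsto (fun t => u t * (deriv b t / b t)) F (𝓝 y)) :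
    Tendsto (fun t => u t * meanCurvature a b t) F (𝓝 (x + 2 * y)) ∧
    (∀ᶠ t in F, meanCurvature a b t = (u t)⁻¹ * (u t * meanCurvature a b t)) ∧
    (x + 2 * y ≠ 0 → Tendsto (fun t => shear a b t / meanCurvature a b t) F
      (𝓝 ((x - 2 * y) / (x + 2 * y)))) := by
  have hpos : ∀ᶠ t in F, 0 < u t := hu.eventually self_mem_nhdsWithin
  have h1 : Tendsto (fun t => u t * meanCurvature a b t) F (𝓝 (x + 2 * y)) := by
    refine (hα.add (hβ.const_mul 2)).congr fun t => ?_
    unfold meanCurvature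
    ring
  have h2 : Tendsto (fun t => u t * shear a b t) F (𝓝 (x - 2 * y)) := by
    refine (hα.sub (hβ.const_mul 2)).congr fun t => ?_
    unfold shear
    ring
  refine ⟨h1, ?_, fun h0 => (h2.div h1 h0).congr' ?_⟩
  · filter_upwards [hpos] with t ht
    rw [inv_mul_cancel_left₀ ht.ne']
  · filter_upwards [hpos] with t ht
    rw [Pi.div_apply, mul_div_mul_left _ _ ht.ne']

/-- If the logarithmic derivatives blow up at proportional rates with positive mean curvature,
the expansion-normalised variables converge. -/
theorem tendsto_statePoint_of_pos (hu : Tendsto u F (𝓝[>] 0))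
    (hα : Tendsto (fun t => u t * (deriv a t / a t)) F (𝓝 x))
    (hβ : Tendsto (fun t => u t * (deriv b t / b t)) F (𝓝 y)) (hxy : 0 < x + 2 * y) :
    Tendsto (meanCurvature a b) F atTop ∧
    Tendsto (statePoint Λ a b) F (𝓝 (1, (x - 2 * y) / (x + 2 * y))) := by
  obtain ⟨h1, h2, h3⟩ := tendsto_meanCurvature_aux hu hα hβ
  have hH : Tendsto (meanCurvature a b) F atTop :=
    ((tendsto_inv_nhdsGT_zero.comp hu).atTop_mul_pos hxy h1).congr' (h2.mono fun t ht => ht.symm)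
  refine ⟨hH, ?_⟩
  have := tendsto_statePoint_of_normalise (Λ := Λ) (hH.eventually_ne_atTop 0)
    (tendsto_normalise_atTop.comp hH) (h3 hxy.ne')
  rwa [mul_one] at this

/-- The analogue of `tendsto_statePoint_of_pos` for negative mean curvature. -/
theorem tendsto_statePoint_of_neg (hu : Tendsto u F (𝓝[>] 0))
    (hα : Tendsto (fun t => u t * (deriv a t / a t)) F (𝓝 x))
    (hβ : Tendsto (fun t => u t * (deriv b t / b t)) F (𝓝 y)) (hxy : x + 2 * y < 0) :
    Tendsto (meanCurvature a b) F atBot ∧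
    Tendsto (statePoint Λ a b) F (𝓝 (-1, -((x - 2 * y) / (x + 2 * y)))) := by
  obtain ⟨h1, h2, h3⟩ := tendsto_meanCurvature_aux hu hα hβ
  have hH : Tendsto (meanCurvature a b) F atBot :=
    ((tendsto_inv_nhdsGT_zero.comp hu).atTop_mul_neg hxy h1).congr' (h2.mono fun t ht => ht.symm)
  refine ⟨hH, ?_⟩
  have := tendsto_statePoint_of_normalise (Λ := Λ) (hH.eventually_ne_atBot 0)
    (tendsto_normalise_atBot.comp hH) (h3 hxy.ne)
  rwa [mul_neg_one] at this

/-! ### Expanding solutions -/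

/-- A solution with `b' > 0` on which `b` runs from `0` to the zero `R` of the profile. -/
structure IsExpanding (Λ M R k T₁ T₂ : ℝ) (a b : ℝ → ℝ) : Prop where
  neg : Λ < 0
  lt : T₁ < T₂
  sol : IsSolution Λ (Ioo T₁ T₂) a b
  pos : ∀ t ∈ Ioo T₁ T₂, 0 < deriv b t
  k_pos : 0 < k
  a_eq : ∀ t ∈ Ioo T₁ T₂, a t = k * deriv b t
  M_pos : 0 < M
  mass : ∀ t ∈ Ioo T₁ T₂, b t * deriv b t ^ 2 = profile |Λ| M (b t)
  R_pos : 0 < R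
  root : profile |Λ| M R = 0
  left : Tendsto b (𝓝[>] T₁) (𝓝[>] 0)
  right : Tendsto b (𝓝[<] T₂) (𝓝 R)

theorem IsMaximalSolution.exists_isExpanding {I : Set ℝ} (h : IsMaximalSolution Λ I a b)
    (hΛ : Λ < 0) (hpos : ∀ t ∈ I, 0 < deriv b t) :
    ∃ M R k T₁ T₂ : ℝ, I = Ioo T₁ T₂ ∧ IsExpanding Λ M R k T₁ T₂ a b := by
  obtain ⟨T₁, T₂, hT, rfl⟩ := h.1.exists_eq_Ioo hΛ
  obtain ⟨k, hk, ha⟩ := h.1.exists_a_eq hpos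
  obtain ⟨M, hM, hmass⟩ := h.1.exists_mass
  obtain ⟨R, hR, hroot, hiff⟩ := exists_profile_root (abs_pos.2 hΛ.ne) hM
  obtain ⟨hmono, himg⟩ := h.image_b hpos hk ha hmass hR hiff
  have hne : (Ioo T₁ T₂).Nonempty := nonempty_Ioo.2 hT
  have hleft : Tendsto b (𝓝[>] T₁) (𝓝 (sInf (b '' Ioo T₁ T₂))) :=
    hmono.monotoneOn.tendsto_nhdsWithin_Ioo_right hne (by rw [himg]; exact bddBelow_Ioo)
  have hright : Tendsto b (𝓝[<] T₂) (𝓝 (sSup (b '' Ioo T₁ T₂))) :=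
    hmono.monotoneOn.tendsto_nhdsWithin_Ioo_left hne (by rw [himg]; exact bddAbove_Ioo)
  rw [himg, csInf_Ioo hR] at hleft
  rw [himg, csSup_Ioo hR] at hright
  refine ⟨M, R, k, T₁, T₂, rfl, hΛ, hT, h.1, hpos, hk, ha, hM, hmass, hR, hroot, ?_, hright⟩
  refine tendsto_nhdsWithin_iff.2 ⟨hleft, ?_⟩
  filter_upwards [Ioo_mem_nhdsGT hT] with t ht using h.1.b_pos t ht

namespace IsExpanding

variable {M R k T₁ T₂ : ℝ}

theorem deriv_deriv_b (h : IsExpanding Λ M R k T₁ T₂ a b) {t : ℝ} (ht : t ∈ Ioo T₁ T₂) :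
    deriv (deriv b) t = -M / (2 * b t ^ 2) - |Λ| / 3 * b t := by
  have h1 := h.sol.two_mul_b_deriv_deriv_b ht
  have h2 := h.mass t ht
  have hb := h.sol.b_pos t ht
  unfold profile at h2
  field_simp
  linear_combination 3 * b t * h1 - 3 * h2

theorem deriv_a_div (h : IsExpanding Λ M R k T₁ T₂ a b) {t : ℝ} (ht : t ∈ Ioo T₁ T₂) :
    deriv a t / a t = deriv (deriv b) t / deriv b t := by
  rw [h.sol.deriv_deriv_b ht, mul_div_cancel_right₀ _ (h.pos t ht).ne']

/-- Unlike b', which blows up as b → 0, the product √b b' has a finite positive limit there; the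
whole analysis of the Kasner end rests on it. -/
theorem sqrt_mul_deriv (h : IsExpanding Λ M R k T₁ T₂ a b) {t : ℝ} (ht : t ∈ Ioo T₁ T₂) :
    √(b t) * deriv b t = √(profile |Λ| M (b t)) := by
  rw [← h.mass t ht, Real.sqrt_mul (h.sol.b_pos t ht).le, Real.sqrt_sq (h.pos t ht).le]

theorem eventually_left (h : IsExpanding Λ M R k T₁ T₂ a b) : ∀ᶠ t in 𝓝[>] T₁, t ∈ Ioo T₁ T₂ :=
  Ioo_mem_nhdsGT h.lt

theorem eventually_right (h : IsExpanding Λ M R k T₁ T₂ a b) : ∀ᶠ t in 𝓝[<] T₂, t ∈ Ioo T₁ T₂ :=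
  Ioo_mem_nhdsLT h.lt

theorem left_zero (h : IsExpanding Λ M R k T₁ T₂ a b) : Tendsto b (𝓝[>] T₁) (𝓝 0) :=
  tendsto_nhds_of_tendsto_nhdsWithin h.left

theorem profile_left (h : IsExpanding Λ M R k T₁ T₂ a b) :
    Tendsto (fun t => √(profile |Λ| M (b t))) (𝓝[>] T₁) (𝓝 √M) := by
  have h1 := ((continuous_profile |Λ| M).tendsto 0).comp h.left_zero
  have h2 : profile |Λ| M 0 = M := by simp [profile]
  rw [h2] at h1
  exact h1.sqrt

/-- The scale b^(3/2) at the Kasner end: since a √b tends to a positive constant, it is proportional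
to the volume factor a b² in the limit. -/
theorem volume_left (h : IsExpanding Λ M R k T₁ T₂ a b) :
    Tendsto (fun t => b t * √(b t)) (𝓝[>] T₁) (𝓝[>] 0) := by
  refine tendsto_nhdsWithin_iff.2 ⟨?_, ?_⟩
  · simpa using h.left_zero.mul h.left_zero.sqrt
  · filter_upwards [h.eventually_left] with t ht
    have := h.sol.b_pos t ht
    exact mul_pos this (Real.sqrt_pos.2 this)

/-- In the scale b^(3/2) the logarithmic derivatives of a and b tend to -√M/2 and √M, the ratio -1 :
2 of the Kasner exponents -1/3 and 2/3; this gives shear over mean curvature -5/3. -/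
theorem limits_left (h : IsExpanding Λ M R k T₁ T₂ a b) :
    Tendsto (meanCurvature a b) (𝓝[>] T₁) atTop ∧
    Tendsto (statePoint Λ a b) (𝓝[>] T₁) (𝓝 (1, -5 / 3)) := by
  have hM : 0 < √M := Real.sqrt_pos.2 h.M_pos
  have hM2 : √M ^ 2 = M := Real.sq_sqrt h.M_pos.le
  have hβ : Tendsto (fun t => b t * √(b t) * (deriv b t / b t)) (𝓝[>] T₁) (𝓝 √M) := by
    refine h.profile_left.congr' ?_
    filter_upwards [h.eventually_left] with t ht
    have hb := h.sol.b_pos t ht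
    rw [← h.sqrt_mul_deriv ht]
    field_simp
  have hα : Tendsto (fun t => b t * √(b t) * (deriv a t / a t)) (𝓝[>] T₁) (𝓝 (-√M / 2)) := by
    have h1 : Tendsto (fun t => (-M / 2 - |Λ| / 3 * b t ^ 3) / √(profile |Λ| M (b t))) (𝓝[>] T₁)
        (𝓝 ((-M / 2 - |Λ| / 3 * 0 ^ 3) / √M)) :=
      (((h.left_zero.pow 3).const_mul _).const_sub _).div h.profile_left hM.ne'
    have h2 : (-M / 2 - |Λ| / 3 * 0 ^ 3) / √M = -√M / 2 := by
      rw [div_eq_iff hM.ne']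
      linear_combination (1 / 2) * hM2
    rw [h2] at h1
    refine h1.congr' ?_
    filter_upwards [h.eventually_left] with t ht
    have hb := h.sol.b_pos t ht
    have hsb : 0 < √(b t) := Real.sqrt_pos.2 hb
    have hsq : √(b t) ^ 2 = b t := Real.sq_sqrt hb.le
    have hd := h.pos t ht
    rw [h.deriv_a_div ht, h.deriv_deriv_b ht, ← h.sqrt_mul_deriv ht]
    field_simp
    rw [hsq]
    ring
  obtain ⟨h1, h2⟩ := tendsto_statePoint_of_pos (Λ := Λ) h.volume_left hα hβ (by linarith)
  refine ⟨h1, ?_⟩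
  have h3 : (-√M / 2 - 2 * √M) / (-√M / 2 + 2 * √M) = -5 / 3 := by
    rw [div_eq_iff (by linarith)]
    ring
  rwa [h3] at h2

theorem deriv_b_right (h : IsExpanding Λ M R k T₁ T₂ a b) :
    Tendsto (deriv b) (𝓝[<] T₂) (𝓝[>] 0) := by
  refine tendsto_nhdsWithin_iff.2 ⟨?_, ?_⟩
  · have h1 := ((((continuous_profile |Λ| M).tendsto R).comp h.right).div h.right
      h.R_pos.ne').sqrt
    rw [h.root, zero_div, Real.sqrt_zero] at h1
    refine h1.congr' ?_
    filter_upwards [h.eventually_right] with t ht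
    have hb := h.sol.b_pos t ht
    simp only [Pi.div_apply, Function.comp_apply]
    rw [← h.mass t ht, mul_div_cancel_left₀ _ hb.ne', Real.sqrt_sq (h.pos t ht).le]
  · filter_upwards [h.eventually_right] with t ht using h.pos t ht

/-- The nonzero limit makes the zero of a = k b' at `T₂` simple. -/
theorem deriv_deriv_b_right (h : IsExpanding Λ M R k T₁ T₂ a b) :
    ∃ D : ℝ, 0 < D ∧ Tendsto (deriv (deriv b)) (𝓝[<] T₂) (𝓝 (-D)) := by
  have hR := h.R_pos
  have hM := h.M_pos
  refine ⟨M / (2 * R ^ 2) + |Λ| / 3 * R, by positivity, ?_⟩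
  have h1 : Tendsto (fun t => -M / (2 * b t ^ 2) - |Λ| / 3 * b t) (𝓝[<] T₂)
      (𝓝 (-M / (2 * R ^ 2) - |Λ| / 3 * R)) :=
    (tendsto_const_nhds.div ((h.right.pow 2).const_mul 2) (by positivity)).sub
      (h.right.const_mul _)
  have h2 : -M / (2 * R ^ 2) - |Λ| / 3 * R = -(M / (2 * R ^ 2) + |Λ| / 3 * R) := by ring
  rw [h2] at h1
  refine h1.congr' ?_
  filter_upwards [h.eventually_right] with t ht using (h.deriv_deriv_b ht).symm

/-- In the scale b' the logarithmic derivative of a becomes b'' → -D < 0, while that of b vanishes.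
Hence H → -∞ and shear over mean curvature tends to 1. -/
theorem limits_right (h : IsExpanding Λ M R k T₁ T₂ a b) :
    Tendsto (meanCurvature a b) (𝓝[<] T₂) atBot ∧
    Tendsto (statePoint Λ a b) (𝓝[<] T₂) (𝓝 (-1, -1)) := by
  obtain ⟨D, hD, hlim⟩ := h.deriv_deriv_b_right
  have hα : Tendsto (fun t => deriv b t * (deriv a t / a t)) (𝓝[<] T₂) (𝓝 (-D)) := by
    refine hlim.congr' ?_
    filter_upwards [h.eventually_right] with t ht
    rw [h.deriv_a_div ht, mul_div_cancel₀ _ (h.pos t ht).ne']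
  have hb0 := tendsto_nhds_of_tendsto_nhdsWithin h.deriv_b_right
  have hβ : Tendsto (fun t => deriv b t * (deriv b t / b t)) (𝓝[<] T₂) (𝓝 0) := by
    simpa using hb0.mul (hb0.div h.right h.R_pos.ne')
  obtain ⟨h1, h2⟩ := tendsto_statePoint_of_neg (Λ := Λ) h.deriv_b_right hα hβ (by linarith)
  refine ⟨h1, ?_⟩
  have h3 : -((-D - 2 * 0) / (-D + 2 * 0)) = -1 := by
    rw [mul_zero, sub_zero, add_zero, div_self (neg_ne_zero.2 hD.ne')]
  rwa [h3] at h2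

end IsExpanding

/-! ### Asymptotics of the scale factors -/

theorem hasDerivAt_cos_phase (w c t : ℝ) :
    HasDerivAt (fun t => Real.cos (w * (c + t))) (-w * Real.sin (w * (c + t))) t := by
  refine (((hasDerivAt_id t).const_add c).const_mul w).cos.congr_deriv ?_
  simp only [id]
  ring

theorem tendsto_cos_phase {w c T : ℝ} (h : Real.cos (w * (c + T)) = 0) :
    Tendsto (fun t => Real.cos (w * (c + t))) (𝓝 T) (𝓝 0) := by
  have := (hasDerivAt_cos_phase w c T).continuousAt.tendsto
  rwa [h] at this

theorem tendsto_deriv_cos_phase (w c T : ℝ) :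
    Tendsto (fun t => -w * Real.sin (w * (c + t))) (𝓝 T) (𝓝 (-w * Real.sin (w * (c + T)))) :=
  (show Continuous fun t => -w * Real.sin (w * (c + t)) by fun_prop).tendsto T

/-- Comparison of a function with a cosine at a common zero, from the right. -/
theorem exists_cos_comparison_right {w T m : ℝ} (hw : 0 < w) {f f' : ℝ → ℝ}
    (hd : ∀ᶠ t in 𝓝[>] T, HasDerivAt f (f' t) t) (hf : Tendsto f (𝓝[>] T) (𝓝 0))
    (hpos : ∀ᶠ t in 𝓝[>] T, 0 < f t)
    (hf' : Tendsto f' (𝓝[>] T) (𝓝 m)) (hm : 0 < m) :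
    ∃ c L : ℝ, 0 < L ∧ Real.cos (w * (c + T)) = 0 ∧
      (∀ᶠ t in 𝓝[>] T, 0 < Real.cos (w * (c + t))) ∧
      Tendsto (fun t => f t / Real.cos (w * (c + t))) (𝓝[>] T) (𝓝 L) := by
  -- The phase at T is -π/2, where the cosine rises through zero with slope w. Any f with a simple
  -- zero is then comparable to it by l'Hôpital's rule, with quotient m/w.
  let c := -T - Real.pi / (2 * w)
  have hphase : w * (c + T) = -(Real.pi / 2) := by simp only [c]; field_simp; ring
  have hcos : Real.cos (w * (c + T)) = 0 := by rw [hphase, Real.cos_neg, Real.cos_pi_div_two]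
  have hsin : -w * Real.sin (w * (c + T)) = w := by
    rw [hphase, Real.sin_neg, Real.sin_pi_div_two]; ring
  have hg' := (tendsto_deriv_cos_phase w c T).mono_left (nhdsWithin_le_nhds (s := Ioi T))
  rw [hsin] at hg'
  have hlim := HasDerivAt.lhopital_zero_nhdsGT hd
    (Eventually.of_forall fun t => hasDerivAt_cos_phase w c t) (hg'.eventually_ne hw.ne') hf
    ((tendsto_cos_phase hcos).mono_left nhdsWithin_le_nhds) (hf'.div hg' hw.ne')
  have hL := div_pos hm hw
  refine ⟨c, m / w, hL, hcos, ?_, hlim⟩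
  filter_upwards [hpos, hlim.eventually_const_lt hL] with t h1 h2
  exact (div_pos_iff_of_pos_left h1).1 h2

/-- Comparison of a function with a cosine at a common zero, from the left. -/
theorem exists_cos_comparison_left {w T m : ℝ} (hw : 0 < w) {f f' : ℝ → ℝ}
    (hd : ∀ᶠ t in 𝓝[<] T, HasDerivAt f (f' t) t) (hf : Tendsto f (𝓝[<] T) (𝓝 0))
    (hpos : ∀ᶠ t in 𝓝[<] T, 0 < f t)
    (hf' : Tendsto f' (𝓝[<] T) (𝓝 (-m))) (hm : 0 < m) :
    ∃ c L : ℝ, 0 < L ∧ Real.cos (w * (c + T)) = 0 ∧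
      (∀ᶠ t in 𝓝[<] T, 0 < Real.cos (w * (c + t))) ∧
      Tendsto (fun t => f t / Real.cos (w * (c + t))) (𝓝[<] T) (𝓝 L) := by
  -- Phase π/2: the cosine falls through zero with slope -w and is positive just before T.
  let c := -T + Real.pi / (2 * w)
  have hphase : w * (c + T) = Real.pi / 2 := by simp only [c]; field_simp; ring
  have hcos : Real.cos (w * (c + T)) = 0 := by rw [hphase, Real.cos_pi_div_two]
  have hsin : -w * Real.sin (w * (c + T)) = -w := by
    rw [hphase, Real.sin_pi_div_two]; ring
  have hg' := (tendsto_deriv_cos_phase w c T).mono_left (nhdsWithin_le_nhds (s := Iio T))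
  rw [hsin] at hg'
  have hw' : -w ≠ 0 := neg_ne_zero.2 hw.ne'
  have hlim := HasDerivAt.lhopital_zero_nhdsLT hd
    (Eventually.of_forall fun t => hasDerivAt_cos_phase w c t) (hg'.eventually_ne hw') hf
    ((tendsto_cos_phase hcos).mono_left nhdsWithin_le_nhds) (hf'.div hg' hw')
  rw [neg_div_neg_eq] at hlim
  have hL := div_pos hm hw
  refine ⟨c, m / w, hL, hcos, ?_, hlim⟩
  filter_upwards [hpos, hlim.eventually_const_lt hL] with t h1 h2
  exact (div_pos_iff_of_pos_left h1).1 h2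

theorem mul_sqrt_rpow_two_thirds {r : ℝ} (hr : 0 < r) : (r * √r) ^ (2 / 3 : ℝ) = r := by
  rw [Real.sqrt_eq_rpow, ← Real.rpow_one_add' hr.le (by norm_num), ← Real.rpow_mul hr.le]
  norm_num

theorem mul_sqrt_rpow_one_third {r : ℝ} (hr : 0 < r) : (r * √r) ^ (1 / 3 : ℝ) = √r := by
  rw [Real.sqrt_eq_rpow, ← Real.rpow_one_add' hr.le (by norm_num), ← Real.rpow_mul hr.le]
  norm_num

namespace IsExpanding

variable {M R k T₁ T₂ : ℝ}

theorem sqrt_pos (h : IsExpanding Λ M R k T₁ T₂ a b) : 0 < √|Λ| :=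
  Real.sqrt_pos.2 (abs_pos.2 h.neg.ne)

theorem pancake (h : IsExpanding Λ M R k T₁ T₂ a b) :
    IsAsymptoticToPancake Λ T₂ (𝓝[<] T₂) a b := by
  obtain ⟨D, hD, hlim⟩ := h.deriv_deriv_b_right
  have hae : ∀ t ∈ Ioo T₁ T₂, a =ᶠ[𝓝 t] fun t => k * deriv b t := fun t ht => by
    filter_upwards [isOpen_Ioo.mem_nhds ht] with u hu using h.a_eq u hu
  have hd : ∀ᶠ t in 𝓝[<] T₂, HasDerivAt a (k * deriv (deriv b) t) t := by
    filter_upwards [h.eventually_right] with t ht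
    exact ((h.sol.b_diff_two t ht).hasDerivAt.const_mul k).congr_of_eventuallyEq (hae t ht)
  have ha0 : Tendsto a (𝓝[<] T₂) (𝓝 0) := by
    have h1 := (tendsto_nhds_of_tendsto_nhdsWithin h.deriv_b_right).const_mul k
    rw [mul_zero] at h1
    refine h1.congr' ?_
    filter_upwards [h.eventually_right] with t ht using (h.a_eq t ht).symm
  have hda := hlim.const_mul k
  rw [mul_neg] at hda
  obtain ⟨c, L, hL, hcos, hpos, hlim⟩ := exists_cos_comparison_left h.sqrt_pos hd ha0
    (h.eventually_right.mono fun t ht => h.sol.a_pos t ht) hda (mul_pos h.k_pos hD)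
  refine ⟨L, R, c, hL, h.R_pos, hcos, hpos, isEquivalent_of_tendsto_one ?_, h.right⟩
  have h1 := hlim.div_const L
  rw [div_self hL.ne'] at h1
  refine h1.congr fun t => ?_
  rw [Pi.div_apply, div_div, mul_comm L]

theorem a_mul_sqrt_left (h : IsExpanding Λ M R k T₁ T₂ a b) :
    Tendsto (fun t => a t * √(b t)) (𝓝[>] T₁) (𝓝 (k * √M)) := by
  refine (h.profile_left.const_mul k).congr' ?_
  filter_upwards [h.eventually_left] with t ht
  rw [← h.sqrt_mul_deriv ht, h.a_eq t ht]
  ring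

/-- Since (b^(3/2))' = (3/2) √b b' tends to (3/2) √M, b^(3/2) has a simple zero and is comparable to
the cosine. The power 2/3 gives b, and the limit of a √b then gives a. -/
theorem kasner (h : IsExpanding Λ M R k T₁ T₂ a b) :
    IsAsymptoticToKasner Λ T₁ (𝓝[>] T₁) a b := by
  have hM : 0 < √M := Real.sqrt_pos.2 h.M_pos
  have hd : ∀ᶠ t in 𝓝[>] T₁, HasDerivAt (fun t => b t * √(b t))
      (3 / 2 * √(profile |Λ| M (b t))) t := by
    filter_upwards [h.eventually_left] with t ht
    have hb := h.sol.b_pos t ht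
    have hb' := (h.sol.b_diff t ht).hasDerivAt
    refine (hb'.mul (hb'.sqrt hb.ne')).congr_deriv ?_
    have hsb : 0 < √(b t) := Real.sqrt_pos.2 hb
    have hsq : √(b t) ^ 2 = b t := Real.sq_sqrt hb.le
    rw [← h.sqrt_mul_deriv ht]
    field_simp
    rw [hsq]
    ring
  obtain ⟨c, L, hL, hcos, hpos, hlim⟩ := exists_cos_comparison_right h.sqrt_pos hd
    (tendsto_nhds_of_tendsto_nhdsWithin h.volume_left)
    (h.volume_left.eventually self_mem_nhdsWithin) (h.profile_left.const_mul (3 / 2))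
    (by positivity)
  have hk := h.k_pos
  have hkM : 0 < k * √M := mul_pos hk hM
  have hLr : 0 < L ^ (1 / 3 : ℝ) := Real.rpow_pos_of_pos hL _
  have hLr2 : 0 < L ^ (2 / 3 : ℝ) := Real.rpow_pos_of_pos hL _
  -- From b^(3/2) ~ L cos: b ~ L^(2/3) cos^(2/3), and a ~ k √M / √b with √b ~ L^(1/3) cos^(1/3).
  refine ⟨k * √M / L ^ (1 / 3 : ℝ), L ^ (2 / 3 : ℝ), c, div_pos hkM hLr, hLr2, hcos, hpos,
    isEquivalent_of_tendsto_one ?_, isEquivalent_of_tendsto_one ?_⟩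
  · have h1 := (h.a_mul_sqrt_left.div (hlim.rpow_const (p := 1 / 3) (Or.inl hL.ne'))
      hLr.ne').div_const (k * √M / L ^ (1 / 3 : ℝ))
    rw [div_self (div_pos hkM hLr).ne'] at h1
    refine h1.congr' ?_
    filter_upwards [hpos, h.eventually_left] with t hx ht
    have hb := h.sol.b_pos t ht
    have hsb : 0 < √(b t) := Real.sqrt_pos.2 hb
    have hxr := Real.rpow_pos_of_pos hx (1 / 3)
    simp only [Pi.div_apply]
    rw [Real.div_rpow (by positivity) hx.le, mul_sqrt_rpow_one_third hb, Real.rpow_neg hx.le]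
    field_simp
  · have h1 := (hlim.rpow_const (p := 2 / 3) (Or.inl hL.ne')).div_const (L ^ (2 / 3 : ℝ))
    rw [div_self hLr2.ne'] at h1
    refine h1.congr' ?_
    filter_upwards [hpos, h.eventually_left] with t hx ht
    have hb := h.sol.b_pos t ht
    simp only [Pi.div_apply]
    rw [Real.div_rpow (by positivity) hx.le, mul_sqrt_rpow_two_thirds hb, div_div, mul_comm (L ^ _)]

theorem a_left (h : IsExpanding Λ M R k T₁ T₂ a b) : Tendsto a (𝓝[>] T₁) atTop := by
  have hsb : Tendsto (fun t => √(b t)) (𝓝[>] T₁) (𝓝[>] 0) := by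
    refine tendsto_nhdsWithin_iff.2 ⟨by simpa using h.left_zero.sqrt, ?_⟩
    filter_upwards [h.eventually_left] with t ht using Real.sqrt_pos.2 (h.sol.b_pos t ht)
  refine (((tendsto_inv_nhdsGT_zero.comp hsb).atTop_mul_pos
    (mul_pos h.k_pos (Real.sqrt_pos.2 h.M_pos)) h.a_mul_sqrt_left)).congr' ?_
  filter_upwards [h.eventually_left] with t ht
  have := Real.sqrt_pos.2 (h.sol.b_pos t ht)
  simp only [Function.comp_apply]
  field_simp

/-- All terms are nonnegative, and 4/b⁴ alone diverges as b → 0. -/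
theorem kretschmann_left (h : IsExpanding Λ M R k T₁ T₂ a b) :
    Tendsto (kretschmann a b) (𝓝[>] T₁) atTop := by
  have h1 : Tendsto (fun t => 4 * (b t)⁻¹ ^ 4) (𝓝[>] T₁) atTop :=
    ((tendsto_pow_atTop (by norm_num)).comp
      (tendsto_inv_nhdsGT_zero.comp h.left)).const_mul_atTop (by norm_num)
  refine tendsto_atTop_mono (fun t => ?_) h1
  have e : 4 * (b t)⁻¹ ^ 4 = 4 / b t ^ 4 := by rw [inv_pow, div_eq_mul_inv]
  rw [e, kretschmann]
  have p1 : 0 ≤ 8 * deriv (deriv b) t ^ 2 / b t ^ 2 := by positivity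
  have p2 : 0 ≤ 4 * deriv b t ^ 4 / b t ^ 4 := by positivity
  have p3 : 0 ≤ 8 * deriv a t ^ 2 * deriv b t ^ 2 / (a t ^ 2 * b t ^ 2) := by positivity
  have p4 : 0 ≤ 8 * deriv b t ^ 2 / b t ^ 4 := by positivity
  have p5 : 0 ≤ 4 * deriv (deriv a) t ^ 2 / a t ^ 2 := by positivity
  linarith

end IsExpanding

end Limits

/-! ### Time reversal -/

section Reversal

variable {Λ : ℝ} {I : Set ℝ} {a b : ℝ → ℝ}

theorem deriv_deriv_comp_neg (f : ℝ → ℝ) (t : ℝ) :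
    deriv (deriv fun t => f (-t)) t = deriv (deriv f) (-t) := by
  have h1 : (deriv fun t => f (-t)) = fun t => -deriv f (-t) := funext fun t => deriv_comp_neg f t
  rw [h1, deriv.fun_neg, deriv_comp_neg (deriv f), neg_neg]

/-- Every term of the system contains an even number of time derivatives. -/
theorem IsSolution.comp_neg (h : IsSolution Λ I a b) :
    IsSolution Λ (-I) (fun t => a (-t)) (fun t => b (-t)) := by
  have hd : ∀ {f : ℝ → ℝ} {t : ℝ}, DifferentiableAt ℝ f (-t) →
      DifferentiableAt ℝ (fun t => f (-t)) t := fun hf => hf.comp _ differentiableAt_id.neg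
  have hd2 : ∀ {f : ℝ → ℝ} {t : ℝ}, DifferentiableAt ℝ (deriv f) (-t) →
      DifferentiableAt ℝ (deriv fun t => f (-t)) t := fun {f t} hf => by
    have h1 : (deriv fun t => f (-t)) = fun t => -deriv f (-t) :=
      funext fun t => deriv_comp_neg f t
    rw [h1]
    exact (hd hf).neg
  refine ⟨h.isOpen.neg, ?_, h.nonempty.neg, fun t ht => h.a_pos _ ht, fun t ht => h.b_pos _ ht,
    fun t ht => hd (h.a_diff _ ht), fun t ht => hd (h.b_diff _ ht),
    fun t ht => hd2 (h.a_diff_two _ ht), fun t ht => hd2 (h.b_diff_two _ ht),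
    fun t ht => ?_, fun t ht => ?_, fun t ht => ?_⟩
  · refine ⟨fun x hx y hy z hz => h.ordConnected.out hy hx ⟨?_, ?_⟩⟩
    · exact neg_le_neg hz.2
    · exact neg_le_neg hz.1
  · rw [deriv_deriv_comp_neg, deriv_comp_neg, deriv_comp_neg, h.evolution_b _ ht]
    ring
  · rw [deriv_deriv_comp_neg, deriv_comp_neg, deriv_comp_neg, h.evolution_a _ ht]
    ring
  · rw [deriv_comp_neg, deriv_comp_neg, neg_mul_neg, neg_sq]
    exact h.constraint _ ht

theorem IsMaximalSolution.comp_neg (h : IsMaximalSolution Λ I a b) :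
    IsMaximalSolution Λ (-I) (fun t => a (-t)) (fun t => b (-t)) := by
  refine ⟨h.1.comp_neg, fun J a' b' hJ hsub ha hb => ?_⟩
  rw [← h.2 (-J) _ _ hJ.comp_neg ?_ (fun t ht => ?_) (fun t ht => ?_), neg_neg]
  · exact fun t ht => hsub (by simpa using ht)
  · simpa using ha (show -t ∈ -I by simpa using ht)
  · simpa using hb (show -t ∈ -I by simpa using ht)

theorem meanCurvature_comp_neg (a b : ℝ → ℝ) (t : ℝ) :
    meanCurvature (fun t => a (-t)) (fun t => b (-t)) t = -meanCurvature a b (-t) := by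
  rw [meanCurvature, deriv_comp_neg, deriv_comp_neg, meanCurvature]
  ring

theorem shear_comp_neg (a b : ℝ → ℝ) (t : ℝ) :
    shear (fun t => a (-t)) (fun t => b (-t)) t = -shear a b (-t) := by
  rw [shear, deriv_comp_neg, deriv_comp_neg, shear]
  ring

/-- Time reversal acts on the state space as p ↦ -p, which interchanges AF and CD. -/
theorem statePoint_comp_neg (Λ : ℝ) (a b : ℝ → ℝ) (t : ℝ) :
    statePoint Λ (fun t => a (-t)) (fun t => b (-t)) t = -statePoint Λ a b (-t) := by
  simp only [statePoint, meanCurvature_comp_neg, shear_comp_neg, neg_sq, neg_div, Prod.neg_mk]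

theorem kretschmann_comp_neg (a b : ℝ → ℝ) (t : ℝ) :
    kretschmann (fun t => a (-t)) (fun t => b (-t)) t = kretschmann a b (-t) := by
  simp only [kretschmann, deriv_deriv_comp_neg, deriv_comp_neg, neg_sq,
    Even.neg_pow (by decide : Even 4)]

theorem cos_phase_neg (w c t : ℝ) : Real.cos (w * (c + -t)) = Real.cos (w * (-c + t)) := by
  rw [← Real.cos_neg]
  ring_nf

theorem IsAsymptoticToPancake.comp_neg {T : ℝ} {l l' : Filter ℝ}
    (h : IsAsymptoticToPancake Λ (-T) l (fun t => a (-t)) (fun t => b (-t)))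
    (hl : Tendsto (fun t => -t) l' l) : IsAsymptoticToPancake Λ T l' a b := by
  obtain ⟨A, B, c, hA, hB, hcos, hpos, ha, hb⟩ := h
  have ha' := ha.comp_tendsto hl
  have hb' := hb.comp hl
  have hpos' := hl.eventually hpos
  simp only [Function.comp_def, neg_neg, cos_phase_neg] at ha' hb' hpos' hcos
  exact ⟨A, B, -c, hA, hB, hcos, hpos', ha', hb'⟩

theorem IsAsymptoticToKasner.comp_neg {T : ℝ} {l l' : Filter ℝ}
    (h : IsAsymptoticToKasner Λ (-T) l (fun t => a (-t)) (fun t => b (-t)))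
    (hl : Tendsto (fun t => -t) l' l) : IsAsymptoticToKasner Λ T l' a b := by
  obtain ⟨A, B, c, hA, hB, hcos, hpos, ha, hb⟩ := h
  have ha' := ha.comp_tendsto hl
  have hb' := hb.comp_tendsto hl
  have hpos' := hl.eventually hpos
  simp only [Function.comp_def, neg_neg, cos_phase_neg] at ha' hb' hpos' hcos
  exact ⟨A, B, -c, hA, hB, hcos, hpos', ha', hb'⟩

end Reversal

/-! ### The orbit in the state space -/

section Orbit

variable {Λ : ℝ} {I : Set ℝ} {a b : ℝ → ℝ}

/-- Multiplied by 9N², the constraint form equals -1/b² by the Hamiltonian constraint: the strict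
inequality is the positive curvature of the spheres. -/
theorem IsSolution.statePoint_mem_stateSpace (h : IsSolution Λ I a b) (hΛ : Λ < 0) {t : ℝ}
    (ht : t ∈ I) : statePoint Λ a b t ∈ stateSpace := by
  have hl : 0 < |Λ| := abs_pos.2 hΛ.ne
  have hb := h.b_pos t ht
  have hc := h.two_mul_deriv_mul_deriv ht
  have hb2 : 0 < 1 / b t ^ 2 := by positivity
  rw [mem_stateSpace, constraintForm]
  simp only [statePoint]
  set H := meanCurvature a b t with hH
  set s := shear a b t with hs
  set N := √(|Λ| + H ^ 2 / 9) with hN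
  have hNpos : 0 < N := Real.sqrt_pos.2 (by positivity)
  have hN2 : N ^ 2 = |Λ| + H ^ 2 / 9 := Real.sq_sqrt (by positivity)
  have habs : |H| ≤ 3 * N := abs_le_of_sq_le_sq (by nlinarith) (by positivity)
  obtain ⟨h1, h2⟩ := abs_le.1 habs
  refine ⟨⟨?_, ?_⟩, ?_⟩
  · rw [le_div_iff₀ (by positivity)]; linarith
  · rw [div_le_iff₀ (by positivity)]; linarith
  · have e : 1 / 9 * (1 - (H / (3 * N)) ^ 2) + 5 / 16 * (H / (3 * N)) ^ 2
        - 3 / 16 * (s / (3 * N)) ^ 2 - 1 / 8 * (H / (3 * N)) * (s / (3 * N))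
        = (N ^ 2 - H ^ 2 / 9 + 5 / 16 * H ^ 2 - 3 / 16 * s ^ 2 - 1 / 8 * H * s)
          / (9 * N ^ 2) := by
      field_simp
      ring
    rw [e, hN2]
    refine div_neg_of_neg_of_pos ?_ (by positivity)
    have e2 : |Λ| + H ^ 2 / 9 - H ^ 2 / 9 + 5 / 16 * H ^ 2 - 3 / 16 * s ^ 2 - 1 / 8 * H * s
        = -(1 / b t ^ 2) := by
      rw [hH, hs, meanCurvature, shear]
      linear_combination hc
    linarith

/-- The quantity separating AF from CD has the sign of a'/a - b'/b, hence, as a' and b' have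
opposite signs, the sign opposite to that of b'. -/
theorem statePoint_snd_add (a b : ℝ → ℝ) (t : ℝ) :
    (statePoint Λ a b t).2 + (statePoint Λ a b t).1 / 3
      = 4 * (deriv a t / a t - deriv b t / b t) / (9 * √(|Λ| + meanCurvature a b t ^ 2 / 9)) := by
  have e : ∀ N : ℝ, shear a b t / (3 * N) + meanCurvature a b t / (3 * N) / 3
      = 4 * (deriv a t / a t - deriv b t / b t) / (9 * N) := by
    intro N
    rcases eq_or_ne N 0 with rfl | hN
    · simp
    · rw [shear, meanCurvature]
      field_simp
      ring
  exact e _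

theorem IsSolution.statePoint_mem_regionCD (h : IsSolution Λ I a b) (hΛ : Λ < 0) {t : ℝ}
    (ht : t ∈ I) (hpos : 0 < deriv b t) : statePoint Λ a b t ∈ regionCD := by
  have hl : 0 < |Λ| := abs_pos.2 hΛ.ne
  have hb := h.b_pos t ht
  have hβ : 0 < deriv b t / b t := div_pos hpos hb
  have hc := h.two_mul_deriv_mul_deriv ht
  have hb2 : 0 < 1 / b t ^ 2 := by positivity
  have hα : deriv a t / a t < 0 := by
    by_contra hneg
    nlinarith [mul_nonneg (not_lt.1 hneg) hβ.le, sq_nonneg (deriv b t / b t)]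
  refine mem_regionCD.2 ⟨h.statePoint_mem_stateSpace hΛ ht, ?_⟩
  rw [statePoint_snd_add]
  exact div_neg_of_neg_of_pos (by linarith) (by positivity)

theorem mem_regionAF_of_neg_mem_regionCD {p : ℝ × ℝ} (hp : -p ∈ regionCD) : p ∈ regionAF := by
  obtain ⟨⟨⟨h1, h2⟩, h3⟩, h4⟩ := mem_regionCD.1 hp
  simp only [Prod.fst_neg, Prod.snd_neg, neg_sq] at h1 h2 h3 h4
  refine mem_regionAF.2 ⟨⟨⟨by linarith, by linarith⟩, ?_⟩, by linarith⟩
  linarith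

theorem IsSolution.continuousOn_meanCurvature (h : IsSolution Λ I a b) :
    ContinuousOn (meanCurvature a b) I :=
  (h.continuousOn_deriv_a.div h.continuousOn_a fun t ht => (h.a_pos t ht).ne').add
    (continuousOn_const.mul
      (h.continuousOn_deriv_b.div h.continuousOn_b fun t ht => (h.b_pos t ht).ne'))

theorem IsSolution.recollapses (h : IsSolution Λ I a b) (hΛ : Λ < 0) : Recollapses I a b :=
  recollapses_of_isBounded (h.isBounded hΛ)
    (fun t ht => ⟨(h.a_pos t ht).ne', h.a_diff t ht⟩)
    (fun t ht => ⟨(h.b_pos t ht).ne', h.b_diff t ht⟩)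

theorem image_Ioo_eq_univ {T₁ T₂ : ℝ} (hT : T₁ < T₂) {f : ℝ → ℝ} (hf : ContinuousOn f (Ioo T₁ T₂))
    (h₁ : Tendsto f (𝓝[>] T₁) atTop) (h₂ : Tendsto f (𝓝[<] T₂) atBot) :
    f '' Ioo T₁ T₂ = univ := by
  refine eq_univ_of_forall fun y => ?_
  obtain ⟨s, hs, hsI⟩ := ((h₁.eventually_ge_atTop y).and (Ioo_mem_nhdsGT hT)).exists
  obtain ⟨u, hu, huI⟩ := ((h₂.eventually_le_atBot y).and (Ioo_mem_nhdsLT hT)).exists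
  exact isPreconnected_Ioo.intermediate_value huI hsI hf ⟨hu, hs⟩

end Orbit

end KantowskiSachs

/-! ### The main theorem -/

theorem mainTheorem4 :
    -- the state space splits into two invariant regions
    (regionAF ∪ regionCD = stateSpace ∧ Disjoint regionAF regionCD ∧
      IsFlowInvariant regionAF ∧ IsFlowInvariant regionCD) ∧
    ∀ (Λ : ℝ), Λ < 0 → ∀ (I : Set ℝ) (a b : ℝ → ℝ), IsMaximalSolution Λ I a b →
      ∃ T₁ T₂ : ℝ, T₁ < T₂ ∧ I = Ioo T₁ T₂ ∧
        -- recollapse and crushing singularities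
        Recollapses I a b ∧
        meanCurvature a b '' I = univ ∧
        Tendsto (meanCurvature a b) (𝓝[>] T₁) atTop ∧
        Tendsto (meanCurvature a b) (𝓝[<] T₂) atBot ∧
        -- the orbit lies in one of the two regions
        ((∀ t ∈ I, statePoint Λ a b t ∈ regionAF) ∨ (∀ t ∈ I, statePoint Λ a b t ∈ regionCD)) ∧
        -- solutions with data in AF
        ((∃ t ∈ I, statePoint Λ a b t ∈ regionAF) →
          Tendsto (statePoint Λ a b) (𝓝[>] T₁) (𝓝 (1, 1)) ∧
          Tendsto (statePoint Λ a b) (𝓝[<] T₂) (𝓝 (-1, 5 / 3)) ∧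
          IsAsymptoticToPancake Λ T₁ (𝓝[>] T₁) a b ∧
          IsAsymptoticToKasner Λ T₂ (𝓝[<] T₂) a b ∧
          Tendsto a (𝓝[<] T₂) atTop ∧ Tendsto b (𝓝[<] T₂) (𝓝 0) ∧
          Tendsto (kretschmann a b) (𝓝[<] T₂) atTop) ∧
        -- solutions with data in CD
        ((∃ t ∈ I, statePoint Λ a b t ∈ regionCD) →
          Tendsto (statePoint Λ a b) (𝓝[>] T₁) (𝓝 (1, -5 / 3)) ∧
          Tendsto (statePoint Λ a b) (𝓝[<] T₂) (𝓝 (-1, -1)) ∧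
          IsAsymptoticToKasner Λ T₁ (𝓝[>] T₁) a b ∧
          IsAsymptoticToPancake Λ T₂ (𝓝[<] T₂) a b ∧
          Tendsto a (𝓝[>] T₁) atTop ∧ Tendsto b (𝓝[>] T₁) (𝓝 0) ∧
          Tendsto (kretschmann a b) (𝓝[>] T₁) atTop) := by
  refine ⟨⟨regionAF_union_regionCD, disjoint_regionAF_regionCD, isFlowInvariant_regionAF,
    isFlowInvariant_regionCD⟩, fun Λ hΛ I a b h => ?_⟩
  obtain ⟨t₀, ht₀⟩ := h.1.nonempty
  rcases (h.1.deriv_b_ne_zero hΛ ht₀).lt_or_gt with hneg | hpos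
  -- Contracting spheres: the time-reversed solution is expanding on (`S₁`, `S₂`), and its limits
  -- are carried back under t ↦ -t, which swaps the two ends and places the orbit in AF.
  · have hneg' : ∀ t ∈ I, deriv b t < 0 := fun t ht => neg_pos.1
      (pos_of_ne_zero h.1.ordConnected h.1.continuousOn_deriv_b.neg
        (fun u hu => neg_ne_zero.2 (h.1.deriv_b_ne_zero hΛ hu)) ht₀ ht (neg_pos.2 hneg))
    have hpos' : ∀ t ∈ -I, 0 < deriv (fun t => b (-t)) t := fun t ht => by
      rw [deriv_comp_neg]
      exact neg_pos.2 (hneg' _ ht)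
    obtain ⟨M, R, k, S₁, S₂, hI, hE⟩ := h.comp_neg.exists_isExpanding hΛ hpos'
    have hI' : I = Ioo (-S₂) (-S₁) := by rw [← neg_neg I, hI, neg_Ioo]
    have hAF : ∀ t ∈ I, statePoint Λ a b t ∈ regionAF := fun t ht => by
      have ht' : -t ∈ -I := by simpa using ht
      have h1 := h.comp_neg.1.statePoint_mem_regionCD hΛ ht' (hpos' _ ht')
      rw [statePoint_comp_neg, neg_neg] at h1
      exact mem_regionAF_of_neg_mem_regionCD h1
    have hl₁ : Tendsto (fun t : ℝ => -t) (𝓝[>] (-S₂)) (𝓝[<] S₂) := tendsto_neg_nhdsGT_neg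
    have hl₂ : Tendsto (fun t : ℝ => -t) (𝓝[<] (-S₁)) (𝓝[>] S₁) := tendsto_neg_nhdsLT_neg
    have hH : ∀ t, -meanCurvature (fun t => a (-t)) (fun t => b (-t)) (-t)
        = meanCurvature a b t := fun t => by rw [meanCurvature_comp_neg, neg_neg, neg_neg]
    have hsp : ∀ t, -statePoint Λ (fun t => a (-t)) (fun t => b (-t)) (-t)
        = statePoint Λ a b t := fun t => by rw [statePoint_comp_neg, neg_neg, neg_neg]
    have hH₁ : Tendsto (meanCurvature a b) (𝓝[>] (-S₂)) atTop :=
      ((tendsto_neg_atBot_atTop.comp hE.limits_right.1).comp hl₁).congr hH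
    have hH₂ : Tendsto (meanCurvature a b) (𝓝[<] (-S₁)) atBot :=
      ((tendsto_neg_atTop_atBot.comp hE.limits_left.1).comp hl₂).congr hH
    refine ⟨-S₂, -S₁, neg_lt_neg hE.lt, hI', h.1.recollapses hΛ, ?_, hH₁, hH₂, Or.inl hAF,
      fun _ => ⟨?_, ?_, ?_, ?_, ?_, ?_, ?_⟩, fun ⟨t, ht, htC⟩ => ?_⟩
    · rw [hI']
      exact image_Ioo_eq_univ (neg_lt_neg hE.lt) (hI' ▸ h.1.continuousOn_meanCurvature) hH₁ hH₂
    · have h1 := (hE.limits_right.2.neg.comp hl₁).congr hsp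
      simpa using h1
    · have h1 := (hE.limits_left.2.neg.comp hl₂).congr hsp
      have h2 : -((1 : ℝ), (-5 / 3 : ℝ)) = (-1, 5 / 3) := by
        rw [Prod.neg_mk]
        norm_num
      rwa [h2] at h1
    · refine IsAsymptoticToPancake.comp_neg ?_ hl₁
      rw [neg_neg]
      exact hE.pancake
    · refine IsAsymptoticToKasner.comp_neg ?_ hl₂
      rw [neg_neg]
      exact hE.kasner
    · simpa [Function.comp_def] using hE.a_left.comp hl₂
    · simpa [Function.comp_def] using hE.left_zero.comp hl₂
    · refine (hE.kretschmann_left.comp hl₂).congr fun t => ?_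
      rw [Function.comp_apply, kretschmann_comp_neg, neg_neg]
    · exact (Set.disjoint_left.1 disjoint_regionAF_regionCD (hAF t ht) htC).elim
  · have hpos' : ∀ t ∈ I, 0 < deriv b t := fun t ht =>
      pos_of_ne_zero h.1.ordConnected h.1.continuousOn_deriv_b
        (fun u hu => h.1.deriv_b_ne_zero hΛ hu) ht₀ ht hpos
    obtain ⟨M, R, k, T₁, T₂, hI, hE⟩ := h.exists_isExpanding hΛ hpos'
    have hCD : ∀ t ∈ I, statePoint Λ a b t ∈ regionCD := fun t ht =>
      h.1.statePoint_mem_regionCD hΛ ht (hpos' t ht)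
    refine ⟨T₁, T₂, hE.lt, hI, h.1.recollapses hΛ, ?_, hE.limits_left.1, hE.limits_right.1,
      Or.inr hCD, fun ⟨t, ht, htA⟩ => ?_, fun _ => ⟨hE.limits_left.2, hE.limits_right.2,
      hE.kasner, hE.pancake, hE.a_left, hE.left_zero, hE.kretschmann_left⟩⟩
    · rw [hI]
      exact image_Ioo_eq_univ hE.lt hE.sol.continuousOn_meanCurvature hE.limits_left.1
        hE.limits_right.1
    · exact (Set.disjoint_left.1 disjoint_regionAF_regionCD htA (hCD t ht)).elim
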